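/- Let $k$ be a field, $G$ a finite group, $X$ a complete set of representatives of the conjugacy classes of $G$, and for $x\in X$ let $C_G(x)$ be the centralizer of $x$. For each $x\in X$ choose representatives $1=\gamma_{1,x},\dots,\gamma_{n_x,x}$ of the right cosets of $C_G(x)$, so $G=\bigsqcup_i C_G(x)\gamma_{i,x}$, and put $x_i=\gamma_{i,x}^{-1}x\gamma_{i,x}$, so that $x_1=x$. For $g_1,\dots,g_n\in G$ and an index $i$, the sequence in $C_G(x)$ determined by $\gamma_{i,x}$ and $(g_1,\dots,g_n)$ is the sequence $(h_{i,1},\dots,h_{i,n})$ given by $$\gamma_{i,x}g_1=h_{i,1}\gamma_{s_i^1,x},\quad \gamma_{s_i^1,x}g_2=h_{i,2}\gamma_{s_i^2,x},\quad\dots,\quad \gamma_{s_i^{n-1},x}g_n=h_{i,n}\gamma_{s_i^n,x}\qquad (h_{i,j}\in C_G(x)).$$ Cohomology is computed by normalized bar complexes. $HH^*(kG)$ is the cohomology of the complex whose $n$-cochains are the maps $\varphi:G^n\to kG$ that vanish whenever an argument is $1$, with $$\delta(\varphi)(g_1,\dots,g_{n+1})=g_1\varphi(g_2,\dots,g_{n+1})+\sum_{i=1}^n(-1)^i\varphi(g_1,\dots,g_ig_{i+1},\dots,g_{n+1})+(-1)^{n+1}\varphi(g_1,\dots,g_n)g_{n+1},$$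 and it is a graded algebra under the cup product $(\varphi\cup\psi)(g_1,\dots,g_{n+m})=\varphi(g_1,\dots,g_n)\,\psi(g_{n+1},\dots,g_{n+m})$ for $\varphi$ of degree $n$ and $\psi$ of degree $m$. For a group $H$, $H^*(H,k)$ is the cohomology of the analogous complex of normalized maps $H^n\to k$, where $H$ acts trivially on $k$ on both sides. **Theorem.** (1) There is a unital associative graded $k$-algebra structure on $\bigoplus_{x\in X}H^*(C_G(x),k)$ whose product is given on representatives as follows. Let $x,y\in X$, and let $\widehat\varphi_x:C_G(x)^n\to k$ and $\widehat\varphi_y:C_G(y)^m\to k$ be normalized cocycles. Then $$[\widehat\varphi_x]\cup[\widehat\varphi_y]=\sum_{z\in X}[(\widehat\varphi_x\cup\widehat\varphi_y)_z],$$ where $(\widehat\varphi_x\cup\widehat\varphi_y)_z:C_G(z)^{n+m}\to k$ is the normalized cocycle $$(\widehat\varphi_x\cup\widehat\varphi_y)_z(h_1,\dots,h_{n+m})=(-1)^{nm}\sum_{(i,j)\in I_1}\widehat\varphi_x(h'_{i,1},\dots,h'_{i,n})\,\widehat\varphi_y(h'_{j,1},\dots,h'_{j,m}).$$ Here $I_1$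 is the set of pairs $(i,j)$ with $1\le i\le n_x$, $1\le j\le n_y$ and $$h_1\cdots h_m\,x_i\,(h_1\cdots h_m)^{-1}\,y_j=z;$$ $(h'_{i,1},\dots,h'_{i,n})$ is the sequence in $C_G(x)$ determined by $\gamma_{i,x}$ and $(h_{m+1},\dots,h_{m+n})$; and $(h'_{j,1},\dots,h'_{j,m})$ is the sequence in $C_G(y)$ determined by $\gamma_{j,y}$ and $(h_1,\dots,h_m)$. (2) With respect to this product, there is an isomorphism of graded $k$-algebras $$HH^*(kG)\xrightarrow{\ \sim\ }\bigoplus_{x\in X}H^*(C_G(x),k),\qquad [\varphi]\longmapsto\sum_{x\in X}[\widehat\varphi_x],$$ where, for a normalized cocycle $\varphi$ of degree $n$, $\widehat\varphi_x$ is the normalized cocycle for which $\widehat\varphi_x(h_1,\dots,h_n)$ is the coefficient of $x$ in $(-1)^{n(n+1)/2}\,h_1\cdots h_n\,\varphi(h_n^{-1},\dots,h_1^{-1})\in kG$. Its inverse sends $\sum_{x\in X}[\widehat\varphi_x]$, with all $\widehat\varphi_x$ of degree $n$, to the class of the normalized cocycle $$\varphi(g_1,\dots,g_n)=(-1)^{n(n+1)/2}\,g_1\cdots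 g_n\sum_{x\in X}\sum_{i=1}^{n_x}\widehat\varphi_x(h'_{i,1},\dots,h'_{i,n})\,x_i,$$ where $(h'_{i,1},\dots,h'_{i,n})$ is the sequence in $C_G(x)$ determined by $\gamma_{i,x}$ and $(g_n^{-1},\dots,g_1^{-1})$. -/

import Mathlib

open scoped DirectSum

noncomputable section

namespace HochschildGroup

/-! ### Normalized bar complexes -/

/-- The differential of the inhomogeneous bar complex with values in `M`, where `L g` and `R g` are
the left and the right action of `g` on `M`:
`(δ f)(g₁, …, gₙ₊₁) = g₁ f(g₂, …, gₙ₊₁) + ∑ᵢ (-1)ⁱ f(g₁, …, gᵢgᵢ₊₁, …, gₙ₊₁)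
  + (-1)ⁿ⁺¹ f(g₁, …, gₙ) gₙ₊₁`. -/
def barD {k H M : Type*} [Field k] [Group H] [AddCommGroup M] [Module k M]
    (L R : H → M →ₗ[k] M) (n : ℕ) :
    ((Fin n → H) → M) →ₗ[k] ((Fin (n + 1) → H) → M) where
  toFun f g := L (g 0) (f (Fin.tail g))
    + ∑ i : Fin n, (-1 : k) ^ ((i : ℕ) + 1) • f (Fin.contractNth i.castSucc (· * ·) g)
    + (-1 : k) ^ (n + 1) • R (g (Fin.last n)) (f (Fin.init g))
  map_add' f₁ f₂ := by
    funext g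
    simp only [Pi.add_apply, map_add, smul_add, Finset.sum_add_distrib]
    abel
  map_smul' c f := by
    funext g
    simp only [Pi.smul_apply, map_smul, RingHom.id_apply, smul_add, Finset.smul_sum,
      smul_comm c]

/-- Normalized cochains: the functions on `Hⁿ` that vanish as soon as one of the arguments is `1`;
these are the functions on `(H ∖ {1})ⁿ`, extended by zero. -/
def normalizedCochains (k H M : Type*) [Field k] [Group H] [AddCommGroup M] [Module k M] (n : ℕ) :
    Submodule k ((Fin n → H) → M) where
  carrier := {f | ∀ g : Fin n → H, (∃ i, g i = 1) → f g = 0}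
  add_mem' hf₁ hf₂ g hg := by simp [hf₁ g hg, hf₂ g hg]
  zero_mem' _ _ := rfl
  smul_mem' c f hf g hg := by simp [hf g hg]

/-- Normalized `n`-cocycles. -/
def cocycles {k H M : Type*} [Field k] [Group H] [AddCommGroup M] [Module k M]
    (L R : H → M →ₗ[k] M) (n : ℕ) : Submodule k ((Fin n → H) → M) :=
  normalizedCochains k H M n ⊓ LinearMap.ker (barD L R n)

/-- The differentials of the normalized `(n - 1)`-cochains. -/
def coboundaries {k H M : Type*} [Field k] [Group H] [AddCommGroup M] [Module k M]
    (L R : H → M →ₗ[k] M) : (n : ℕ) → Submodule k ((Fin n → H) → M)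
  | 0 => ⊥
  | n + 1 => (normalizedCochains k H M n).map (barD L R n)

/-- The cohomology of the normalized bar complex: cocycles modulo coboundaries. -/
abbrev BarCohomology {k H M : Type*} [Field k] [Group H] [AddCommGroup M] [Module k M]
    (L R : H → M →ₗ[k] M) (n : ℕ) : Type _ :=
  cocycles L R n ⧸ (coboundaries L R n).submoduleOf (cocycles L R n)

/-! ### Group cohomology with trivial coefficients -/

/-- Normalized inhomogeneous `n`-cocycles of `H` with values in the trivial module `k`. -/
abbrev groupCocycles (k H : Type*) [Field k] [Group H] (n : ℕ) : Submodule k ((Fin n → H) → k) :=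
  cocycles (fun _ : H => LinearMap.id) (fun _ : H => LinearMap.id) n

/-- `Hⁿ(H, k)`, computed by the normalized bar resolution. -/
abbrev GroupCohomology (k H : Type*) [Field k] [Group H] (n : ℕ) : Type _ :=
  BarCohomology (k := k) (M := k) (fun _ : H => LinearMap.id) (fun _ : H => LinearMap.id) n

/-- The cohomology class of a cocycle in `Hⁿ(H, k)`. -/
def groupClass {k H : Type*} [Field k] [Group H] {n : ℕ} (f : groupCocycles k H n) :
    GroupCohomology k H n :=
  Submodule.Quotient.mk f

/-! ### Hochschild cohomology of the group algebra -/

/-- Left multiplication by `g` on `kG`. -/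
def leftMul (k : Type*) {G : Type*} [Field k] [Group G] (g : G) :
    MonoidAlgebra k G →ₗ[k] MonoidAlgebra k G :=
  LinearMap.mulLeft k (MonoidAlgebra.single g 1)

/-- Right multiplication by `g` on `kG`. -/
def rightMul (k : Type*) {G : Type*} [Field k] [Group G] (g : G) :
    MonoidAlgebra k G →ₗ[k] MonoidAlgebra k G :=
  LinearMap.mulRight k (MonoidAlgebra.single g 1)

/-- Normalized Hochschild `n`-cocycles of `kG` with values in `kG`, as functions on `Gⁿ`. -/
abbrev hochschildCocycles (k G : Type*) [Field k] [Group G] (n : ℕ) :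
    Submodule k ((Fin n → G) → MonoidAlgebra k G) :=
  cocycles (leftMul k) (rightMul k) n

/-- `HHⁿ(kG)`, computed by the normalized bar resolution. -/
def HH (k G : Type*) [Field k] [Group G] (n : ℕ) : Type _ :=
  BarCohomology (leftMul k (G := G)) (rightMul k) n

instance (k G : Type*) [Field k] [Group G] (n : ℕ) : AddCommGroup (HH k G n) :=
  inferInstanceAs (AddCommGroup (BarCohomology (leftMul k (G := G)) (rightMul k) n))

instance (k G : Type*) [Field k] [Group G] (n : ℕ) : Module k (HH k G n) :=
  inferInstanceAs (Module k (BarCohomology (leftMul k (G := G)) (rightMul k) n))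

/-- The cohomology class of a Hochschild cocycle. -/
def hochschildClass {k G : Type*} [Field k] [Group G] (n : ℕ) :
    hochschildCocycles k G n →ₗ[k] HH k G n :=
  Submodule.mkQ _

/-- The cup product of Hochschild cochains:
`(f ∪ g)(a₁, …, aₙ₊ₘ) = f(a₁, …, aₙ) g(aₙ₊₁, …, aₙ₊ₘ)`. -/
def cup {k G : Type*} [Field k] [Group G] {n m : ℕ} (f : (Fin n → G) → MonoidAlgebra k G)
    (g : (Fin m → G) → MonoidAlgebra k G) : (Fin (n + m) → G) → MonoidAlgebra k G :=
  fun a => f (fun i => a (Fin.castAdd m i)) * g (fun j => a (Fin.natAdd n j))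

/-! ### The cup product on Hochschild cohomology

To avoid casts, cochains are evaluated below at the initial segments of infinite sequences. -/

section Cup

/-- The first `n` terms of a sequence. -/
def seg {G : Type*} (n : ℕ) (a : ℕ → G) : Fin n → G := fun i => a i

/-- The sequence shifted by `n`. -/
def shift {G : Type*} (n : ℕ) (a : ℕ → G) : ℕ → G := fun i => a (n + i)

/-- The sequence with its terms `i` and `i + 1` multiplied together. -/
def contr {G : Type*} [Group G] (i : ℕ) (a : ℕ → G) : ℕ → G :=
  fun j => if j < i then a j else if j = i then a j * a (j + 1) else a (j + 1)

theorem exists_seg {G : Type*} [Group G] {n : ℕ} (g : Fin n → G) : ∃ a : ℕ → G, seg n a = g :=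
  ⟨fun i => if h : i < n then g ⟨i, h⟩ else 1, by funext i; simp [seg]⟩

theorem barD_seg {k H M : Type*} [Field k] [Group H] [AddCommGroup M] [Module k M]
    (L R : H → M →ₗ[k] M) (n : ℕ) (f : (Fin n → H) → M) (a : ℕ → H) :
    barD L R n f (seg (n + 1) a) = L (a 0) (f (seg n (shift 1 a)))
      + ∑ i ∈ Finset.range n, (-1 : k) ^ (i + 1) • f (seg n (contr i a))
      + (-1 : k) ^ (n + 1) • R (a n) (f (seg n a)) := by
  have h1 : Fin.tail (seg (n + 1) a) = seg n (shift 1 a) := by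
    funext i
    simp [Fin.tail, seg, shift, add_comm]
  have h2 : Fin.init (seg (n + 1) a) = seg n a := by
    funext i
    simp [Fin.init, seg]
  have h3 : ∀ i : Fin n, Fin.contractNth i.castSucc (· * ·) (seg (n + 1) a)
      = seg n (contr i a) := by
    intro i
    funext j
    simp [Fin.contractNth, seg, contr]
  rw [Finset.sum_range (n := n) (fun i => (-1 : k) ^ (i + 1) • f (seg n (contr i a)))]
  simp only [barD, LinearMap.coe_mk, AddHom.coe_mk, h1, h2, h3]
  simp [seg]

theorem cup_seg {k G : Type*} [Field k] [Group G] {n m : ℕ}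
    (f : (Fin n → G) → MonoidAlgebra k G) (g : (Fin m → G) → MonoidAlgebra k G) (a : ℕ → G) :
    cup f g (seg (n + m) a) = f (seg n a) * g (seg m (shift n a)) := rfl

theorem barD_cup {k G : Type*} [Field k] [Group G] {n m : ℕ}
    (f : (Fin n → G) → MonoidAlgebra k G) (g : (Fin m → G) → MonoidAlgebra k G) (a : ℕ → G) :
    barD (leftMul k) (rightMul k) (n + m) (cup f g) (seg (n + m + 1) a)
      = barD (leftMul k) (rightMul k) n f (seg (n + 1) a) * g (seg m (shift (n + 1) a))
        + (-1 : k) ^ n • (f (seg n a) *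
          barD (leftMul k) (rightMul k) m g (seg (m + 1) (shift n a))) := by
  have hs : ∀ p q : ℕ, shift p (shift q a) = shift (q + p) a := by
    intro p q; funext i; simp [shift, add_assoc]
  have e1 : ∀ i ∈ Finset.range n, (-1 : k) ^ (i + 1) • cup f g (seg (n + m) (contr i a))
      = ((-1 : k) ^ (i + 1) • f (seg n (contr i a))) * g (seg m (shift (n + 1) a)) := by
    intro i hi
    have hi := Finset.mem_range.1 hi
    have : shift n (contr i a) = shift (n + 1) a := by
      funext j
      have h1 : ¬ n + j < i := by omega
      have h2 : ¬ n + j = i := by omega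
      simp only [shift, contr, h1, h2, if_false]
      congr 1; omega
    rw [cup_seg, this, smul_mul_assoc]
  have e2 : ∀ i ∈ Finset.range m, (-1 : k) ^ (n + i + 1) • cup f g (seg (n + m) (contr (n + i) a))
      = (-1 : k) ^ n • (f (seg n a) *
          ((-1 : k) ^ (i + 1) • g (seg m (contr i (shift n a))))) := by
    intro i hi
    have h1 : seg n (contr (n + i) a) = seg n a := by
      funext j
      have : (j : ℕ) < n + i := by omega
      simp [seg, contr, this]
    have h2 : shift n (contr (n + i) a) = contr i (shift n a) := by
      funext j
      simp [shift, contr, add_assoc]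
    rw [cup_seg, h1, h2, mul_smul_comm, smul_smul, ← pow_add, add_assoc]
  rw [barD_seg, barD_seg, barD_seg, Finset.sum_range_add, Finset.sum_congr rfl e1,
    Finset.sum_congr rfl e2, ← Finset.sum_mul, ← Finset.smul_sum, ← Finset.mul_sum]
  simp only [cup_seg, hs, leftMul, rightMul, LinearMap.mulLeft_apply, LinearMap.mulRight_apply]
  rw [add_comm 1 n]
  have h0 : shift n a 0 = a n := rfl
  have hm : shift n a m = a (n + m) := rfl
  rw [h0, hm]
  simp only [add_mul, mul_add, smul_add, mul_assoc, smul_mul_assoc, mul_smul_comm, smul_smul,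
    ← pow_add]
  have hz : ∀ y : MonoidAlgebra k G, (-1 : k) ^ (n + 1) • y = -((-1 : k) ^ n • y) := by
    intro y; rw [pow_succ, mul_neg_one, neg_smul]
  rw [← add_assoc n m 1,
    hz (f (seg n a) * (MonoidAlgebra.single (a n) 1 * g (seg m (shift (n + 1) a))))]
  abel

theorem mem_cocycles_iff {k H M : Type*} [Field k] [Group H] [AddCommGroup M] [Module k M]
    {L R : H → M →ₗ[k] M} {n : ℕ} {f : (Fin n → H) → M} :
    f ∈ cocycles L R n ↔ f ∈ normalizedCochains k H M n ∧
      ∀ a : ℕ → H, barD L R n f (seg (n + 1) a) = 0 := by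
  rw [cocycles, Submodule.mem_inf, LinearMap.mem_ker]
  refine and_congr_right fun _ => ⟨fun h a => by rw [h]; rfl, fun h => ?_⟩
  funext g
  obtain ⟨a, rfl⟩ := exists_seg g
  exact h a

theorem coboundaries_of_seg {k H M : Type*} [Field k] [Group H] [AddCommGroup M] [Module k M]
    {L R : H → M →ₗ[k] M} {n p : ℕ} (h : p + 1 = n) {f : (Fin n → H) → M} {u : (Fin p → H) → M}
    (hu : u ∈ normalizedCochains k H M p)
    (hfu : ∀ a : ℕ → H, f (seg n a) = barD L R p u (seg (p + 1) a)) : f ∈ coboundaries L R n := by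
  subst h
  refine ⟨u, hu, ?_⟩
  funext g
  obtain ⟨a, rfl⟩ := exists_seg g
  exact (hfu a).symm

theorem exists_of_coboundaries {k H M : Type*} [Field k] [Group H] [AddCommGroup M] [Module k M]
    {L R : H → M →ₗ[k] M} {n : ℕ} {f : (Fin n → H) → M} (hf : f ∈ coboundaries L R n) :
    f = 0 ∨ ∃ p, ∃ _ : p + 1 = n, ∃ u ∈ normalizedCochains k H M p,
      ∀ a : ℕ → H, f (seg n a) = barD L R p u (seg (p + 1) a) := by
  cases n with
  | zero => exact Or.inl ((Submodule.mem_bot k).1 hf)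
  | succ p =>
    obtain ⟨u, hu, rfl⟩ := hf
    exact Or.inr ⟨p, rfl, u, hu, fun _ => rfl⟩

variable {k G : Type*} [Field k] [Group G]

theorem cup_normalized {n m : ℕ} {f : (Fin n → G) → MonoidAlgebra k G}
    {g : (Fin m → G) → MonoidAlgebra k G} (hf : f ∈ normalizedCochains k G (MonoidAlgebra k G) n)
    (hg : g ∈ normalizedCochains k G (MonoidAlgebra k G) m) :
    cup f g ∈ normalizedCochains k G (MonoidAlgebra k G) (n + m) := by
  rintro a ⟨i, hi⟩
  induction i using Fin.addCases with
  | left i => simp [cup, hf (fun i => a (Fin.castAdd m i)) ⟨i, hi⟩]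
  | right j => simp [cup, hg (fun j => a (Fin.natAdd n j)) ⟨j, hi⟩]

theorem cup_cocycle {n m : ℕ} {f : (Fin n → G) → MonoidAlgebra k G}
    {g : (Fin m → G) → MonoidAlgebra k G} (hf : f ∈ hochschildCocycles k G n)
    (hg : g ∈ hochschildCocycles k G m) : cup f g ∈ hochschildCocycles k G (n + m) := by
  rw [mem_cocycles_iff] at hf hg ⊢
  refine ⟨cup_normalized hf.1 hg.1, fun a => ?_⟩
  rw [barD_cup, hf.2, hg.2]
  simp

theorem cup_coboundary_left {n m : ℕ} {f : (Fin n → G) → MonoidAlgebra k G}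
    {g : (Fin m → G) → MonoidAlgebra k G} (hf : f ∈ coboundaries (leftMul k) (rightMul k) n)
    (hg : g ∈ hochschildCocycles k G m) :
    cup f g ∈ coboundaries (leftMul k) (rightMul k) (n + m) := by
  rw [mem_cocycles_iff] at hg
  rcases exists_of_coboundaries hf with rfl | ⟨p, hp, u, hu, h⟩
  · convert Submodule.zero_mem _
    funext a
    simp [cup]
  · refine coboundaries_of_seg (p := p + m) (by omega) (cup_normalized hu hg.1) fun a => ?_
    rw [barD_cup, hg.2, cup_seg, h]
    subst hp
    simp

theorem cup_coboundary_right {n m : ℕ} {f : (Fin n → G) → MonoidAlgebra k G}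
    {g : (Fin m → G) → MonoidAlgebra k G} (hf : f ∈ hochschildCocycles k G n)
    (hg : g ∈ coboundaries (leftMul k) (rightMul k) m) :
    cup f g ∈ coboundaries (leftMul k) (rightMul k) (n + m) := by
  rw [mem_cocycles_iff] at hf
  rcases exists_of_coboundaries hg with rfl | ⟨p, hp, u, hu, h⟩
  · convert Submodule.zero_mem _
    funext a
    simp [cup]
  · refine coboundaries_of_seg (p := n + p) (u := (-1 : k) ^ n • cup f u) (by omega)
      (Submodule.smul_mem _ _ (cup_normalized hf.1 hu)) fun a => ?_
    rw [map_smul, Pi.smul_apply, barD_cup, hf.2, cup_seg, h, zero_mul, zero_add, smul_smul,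
      ← mul_pow]
    simp

/-- The cup product of cocycles, as a bilinear map. -/
def cocycleCup (n m : ℕ) : hochschildCocycles k G n →ₗ[k] hochschildCocycles k G m →ₗ[k]
    hochschildCocycles k G (n + m) :=
  LinearMap.mk₂ k (fun f g => ⟨cup f.1 g.1, cup_cocycle f.2 g.2⟩)
    (fun _ _ _ => by ext1; funext a; simp [cup, add_mul])
    (fun _ _ _ => by ext1; funext a; simp [cup])
    (fun _ _ _ => by ext1; funext a; simp [cup, mul_add])
    (fun _ _ _ => by ext1; funext a; simp [cup])

/-- The cup product `HHⁿ(kG) × HHᵐ(kG) → HHⁿ⁺ᵐ(kG)`, induced by the one of cochains. -/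
def hhMul (n m : ℕ) : HH k G n →ₗ[k] HH k G m →ₗ[k] HH k G (n + m) :=
  Submodule.liftQ _
    (LinearMap.flip (Submodule.liftQ _
      ((cocycleCup n m).compr₂ (hochschildClass (n + m))).flip
      (fun g hg => by
        rw [LinearMap.mem_ker]
        ext1 f
        exact (Submodule.Quotient.mk_eq_zero _).2 (cup_coboundary_right f.2 hg))))
    (fun f hf => by
      rw [LinearMap.mem_ker]
      ext1 g
      obtain ⟨g, rfl⟩ := Submodule.Quotient.mk_surjective _ g
      exact (Submodule.Quotient.mk_eq_zero _).2 (cup_coboundary_left hf g.2))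

theorem hhMul_class {n m : ℕ} (f : hochschildCocycles k G n) (g : hochschildCocycles k G m) :
    hhMul n m (hochschildClass n f) (hochschildClass m g)
      = hochschildClass (n + m) ⟨cup f.1 g.1, cup_cocycle f.2 g.2⟩ := rfl

theorem hochschildClass_surjective (n : ℕ) :
    Function.Surjective (hochschildClass n : hochschildCocycles k G n → HH k G n) :=
  Submodule.Quotient.mk_surjective _

/-- The constant `0`-cochain with value `r ∈ k`. -/
def scalarCocycle : k →ₗ[k] hochschildCocycles k G 0 where
  toFun r := ⟨fun _ => r • 1, by
    rw [mem_cocycles_iff]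
    refine ⟨fun g ⟨i, _⟩ => i.elim0, fun a => ?_⟩
    rw [barD_seg]
    simp [leftMul, rightMul]⟩
  map_add' r s := by ext1; funext a; simp [add_smul]
  map_smul' r s := by ext1; funext a; simp [mul_smul]

theorem mk_class_eq {p q : ℕ} (h : p = q) (f : hochschildCocycles k G p)
    (g : hochschildCocycles k G q) (hfg : ∀ a : ℕ → G, f.1 (seg p a) = g.1 (seg q a)) :
    (GradedMonoid.mk p (hochschildClass p f) : GradedMonoid (HH k G))
      = GradedMonoid.mk q (hochschildClass q g) := by
  subst h
  have : f = g := by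
    ext1
    funext x
    obtain ⟨a, rfl⟩ := exists_seg x
    exact hfg a
  rw [this]

instance : GradedMonoid.GMul (HH k G) where
  mul {n m} a b := hhMul n m a b

instance : GradedMonoid.GOne (HH k G) where
  one := hochschildClass 0 (scalarCocycle 1)

theorem shift_zero {G : Type*} (a : ℕ → G) : shift 0 a = a := by
  funext i; simp [shift]

/-- The graded ring structure on `HH*(kG)` given by the cup product. -/
instance : DirectSum.GSemiring (HH k G) where
  mul_zero a := map_zero (hhMul _ _ a)
  zero_mul b := LinearMap.congr_fun (map_zero (hhMul _ _)) b
  mul_add a b c := map_add (hhMul _ _ a) b c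
  add_mul a b c := LinearMap.congr_fun (map_add (hhMul _ _) a b) c
  one_mul a := by
    obtain ⟨n, a⟩ := a
    obtain ⟨f, rfl⟩ := hochschildClass_surjective n a
    refine mk_class_eq (zero_add n) ⟨cup (scalarCocycle 1).1 f.1, _⟩ f fun a => ?_
    refine (cup_seg _ _ a).trans ?_
    simp [scalarCocycle, shift_zero]
  mul_one a := by
    obtain ⟨n, a⟩ := a
    obtain ⟨f, rfl⟩ := hochschildClass_surjective n a
    refine mk_class_eq (add_zero n) ⟨cup f.1 (scalarCocycle 1).1, _⟩ f fun a => ?_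
    refine (cup_seg _ _ a).trans ?_
    simp [scalarCocycle]
  mul_assoc a b c := by
    obtain ⟨n, a⟩ := a
    obtain ⟨m, b⟩ := b
    obtain ⟨l, c⟩ := c
    obtain ⟨f, rfl⟩ := hochschildClass_surjective n a
    obtain ⟨g, rfl⟩ := hochschildClass_surjective m b
    obtain ⟨h, rfl⟩ := hochschildClass_surjective l c
    refine mk_class_eq (add_assoc n m l)
      ⟨cup (cup f.1 g.1) h.1, cup_cocycle (cup_cocycle f.2 g.2) h.2⟩
      ⟨cup f.1 (cup g.1 h.1), cup_cocycle f.2 (cup_cocycle g.2 h.2)⟩ fun a => ?_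
    simp only [cup_seg, mul_assoc]
    have : shift (n + m) a = shift m (shift n a) := by
      funext i; simp [shift, add_assoc]
    rw [this]
  natCast n := n • hochschildClass 0 (scalarCocycle 1)
  natCast_zero := zero_smul _ _
  natCast_succ n := succ_nsmul _ _

/-- The `k`-algebra structure on `HH*(kG)`. -/
instance : DirectSum.GAlgebra k (HH k G) where
  toFun := ((hochschildClass 0).comp (scalarCocycle (k := k) (G := G))).toAddMonoidHom
  map_one := rfl
  map_mul r s := by
    refine mk_class_eq (add_zero 0).symm (scalarCocycle (r * s))
      ⟨cup (scalarCocycle r).1 (scalarCocycle s).1, cup_cocycle (scalarCocycle r).2 (scalarCocycle s).2⟩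
      fun a => ?_
    refine Eq.trans ?_ (cup_seg _ _ a).symm
    simp [scalarCocycle, smul_smul, mul_comm]
  commutes r x := by
    obtain ⟨n, a⟩ := x
    obtain ⟨f, rfl⟩ := hochschildClass_surjective n a
    refine mk_class_eq ((zero_add n).trans (add_zero n).symm)
      ⟨cup (scalarCocycle r).1 f.1, cup_cocycle (scalarCocycle r).2 f.2⟩
      ⟨cup f.1 (scalarCocycle r).1, cup_cocycle f.2 (scalarCocycle r).2⟩ fun a => ?_
    refine (cup_seg _ _ a).trans (Eq.trans ?_ (cup_seg _ _ a).symm)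
    simp [scalarCocycle, shift_zero]
  smul_def r x := by
    obtain ⟨n, a⟩ := x
    obtain ⟨f, rfl⟩ := hochschildClass_surjective n a
    refine mk_class_eq (zero_add n).symm (r • f)
      ⟨cup (scalarCocycle r).1 f.1, cup_cocycle (scalarCocycle r).2 f.2⟩ fun a => ?_
    refine Eq.trans ?_ (cup_seg _ _ a).symm
    simp [scalarCocycle, shift_zero]

end Cup

/-! ### Conjugacy classes and centralizers -/

/-- The centralizer `C_G(x)`. -/
abbrev Cent {G : Type*} [Group G] (x : G) : Subgroup G := Subgroup.centralizer {x}

/-- The choices on which the decomposition depends: a set `X` of representatives of the conjugacy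
classes of `G` and, for each `x ∈ X`, a set `S x` of representatives `γ` of the right cosets
`C_G(x) γ` with `1 ∈ S x`, that is, every element of `G` is `h γ` for a unique pair
`(h, γ) ∈ C_G(x) × S x`. -/
structure ClassData (G : Type*) [Group G] where
  /-- representatives of the conjugacy classes -/
  X : Finset G
  existsUnique_conj : ∀ g : G, ∃! x, x ∈ X ∧ IsConj x g
  /-- representatives of the right cosets of the centralizers -/
  S : X → Finset G
  isComplement : ∀ x : X, Subgroup.IsComplement (Cent (x : G) : Set G) (S x : Set G)
  one_mem : ∀ x : X, (1 : G) ∈ S x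

section Decomposition

variable {G : Type*} [Group G]

/-- The factor `h ∈ C_G(x)` of `g = h γ`, `γ ∈ S x`. -/
def ClassData.centPart (D : ClassData G) (x : D.X) (g : G) : Cent (x : G) := ((D.isComplement x).equiv g).1

/-- The factor `γ ∈ S x` of `g = h γ`, `h ∈ C_G(x)`. -/
def ClassData.cosetRep (D : ClassData G) (x : D.X) (g : G) : G := ((D.isComplement x).equiv g).2

/-- The sequence `(h₁, …, hₙ)` in `C_G(x)` determined by `γ` and `(g₁, …, gₙ)` through
`γ g₁ = h₁ γ'`, `γ' g₂ = h₂ γ''`, …, with `γ', γ'', …` in `S x`. -/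
def ClassData.hSeq (D : ClassData G) (x : D.X) : {n : ℕ} → G → (Fin n → G) → (Fin n → Cent (x : G))
  | 0, _, _ => Fin.elim0
  | _ + 1, γ, g =>
    Fin.cons (D.centPart x (γ * g 0)) (ClassData.hSeq D x (D.cosetRep x (γ * g 0)) (Fin.tail g))

/-- The degree `n` part `⨁_{x ∈ X} Hⁿ(C_G(x), k)`. -/
abbrev CentralizerCohomology (k : Type*) [Field k] (D : ClassData G) (n : ℕ) : Type _ :=
  ⨁ x : D.X, GroupCohomology k (Cent (x : G)) n

/-- The product `g₁ ⋯ gₙ`. -/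
def tupleProd {n : ℕ} (g : Fin n → G) : G := (List.ofFn g).prod

/-- The tuple `(gₙ⁻¹, …, g₁⁻¹)`. -/
def revInv {n : ℕ} (g : Fin n → G) : Fin n → G := fun i => (g i.rev)⁻¹

/-- `φ̂_x(h₁, …, hₙ)`: the coefficient of `x` in
`(-1)^{n(n+1)/2} h₁ ⋯ hₙ φ(hₙ⁻¹, …, h₁⁻¹)`. -/
def hat {k : Type*} [Field k] {n : ℕ} (φ : (Fin n → G) → MonoidAlgebra k G) (x : G) :
    (Fin n → Cent x) → k :=
  fun h => ((-1 : k) ^ (n * (n + 1) / 2) •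
    (MonoidAlgebra.single (tupleProd fun i => (h i : G)) (1 : k) *
      φ (revInv fun i => (h i : G)))).coeff x

/-- The cochain of `kG` attached to a family of cochains `ψ_x` of the `C_G(x)`:
`(g₁, …, gₙ) ↦ (-1)^{n(n+1)/2} g₁ ⋯ gₙ ∑_{x ∈ X} ∑_{γ ∈ S x} ψ_x(h₁', …, hₙ') γ⁻¹ x γ`,
where `h'` is determined by `γ` and `(gₙ⁻¹, …, g₁⁻¹)`. -/
def unhat (D : ClassData G) {k : Type*} [Field k] {n : ℕ} (ψ : (x : D.X) → (Fin n → Cent (x : G)) → k) :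
    (Fin n → G) → MonoidAlgebra k G :=
  fun g => (-1 : k) ^ (n * (n + 1) / 2) • (MonoidAlgebra.single (tupleProd g) (1 : k) *
    ∑ x : D.X, ∑ γ ∈ D.S x,
      MonoidAlgebra.single (γ⁻¹ * (x : G) * γ) (ψ x (D.hSeq x γ (revInv g))))

/-- The product `(a ∪ b)_z` of a cochain `a` of `C_G(x)` and a cochain `b` of `C_G(y)`:
`(h₁, …, hₙ₊ₘ) ↦ (-1)^{nm} ∑ a(h_{γ,1}', …, h_{γ,n}') b(h_{η,1}', …, h_{η,m}')`, the sum being over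
the pairs `(γ, η) ∈ S x × S y` with
`h₁ ⋯ hₘ (γ⁻¹ x γ) (h₁ ⋯ hₘ)⁻¹ (η⁻¹ y η) = z`; here `h_γ'` is determined by `γ` and
`(hₘ₊₁, …, hₘ₊ₙ)`, and `h_η'` by `η` and `(h₁, …, hₘ)`. -/
def twistedCup [DecidableEq G] (D : ClassData G) {k : Type*} [Field k] {n m : ℕ} {x y : D.X}
    (a : (Fin n → Cent (x : G)) → k) (b : (Fin m → Cent (y : G)) → k) (z : D.X) :
    (Fin (n + m) → Cent (z : G)) → k :=
  fun h =>
    let u : Fin m → G := fun j => h (Fin.cast (Nat.add_comm m n) (Fin.castAdd n j))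
    let v : Fin n → G := fun i => h (Fin.cast (Nat.add_comm m n) (Fin.natAdd m i))
    (-1 : k) ^ (n * m) *
      ∑ p ∈ (D.S x ×ˢ D.S y).filter (fun p : G × G =>
          tupleProd u * (p.1⁻¹ * (x : G) * p.1) * (tupleProd u)⁻¹ * (p.2⁻¹ * (y : G) * p.2) = z),
        a (D.hSeq x p.1 v) * b (D.hSeq y p.2 u)

end Decomposition

end HochschildGroup

end

open HochschildGroup

/-! A Hochschild cochain φ is read through functions of vertices v₀, …, vₙ ∈ G: the coefficient of x
in ± vₙ φ(vₙ⁻¹vₙ₋₁, …, v₁⁻¹v₀) v₀⁻¹ (`hochschildHomog`). This function is invariant under left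
translation by C_G(x), and the bar differential becomes the alternating sum of faces; the sign
absorbs the reversal of the vertices. Every element of G is γ⁻¹xγ for exactly one pair (x, γ), so φ
amounts to a family, indexed by X, of invariant homogeneous cochains on the free C_G(x)-set G
(`eq_of_hochschildHomog_eq`, `hochschildHomog_ofHomog`).

In these terms φ ↦ φ̂_x is restriction to vertices in C_G(x) (`trivHomog_hat`), and the inverse
formula is pullback along the C_G(x)-equivariant retraction hγ ↦ h of G onto C_G(x)
(`hochschildHomog_unhat`). Restriction after pullback is the identity on cochains (`hat_unhat`).
Pullback after restriction is homotopic to the identity through the prism operator, which respects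
equivariance and normalization (`faceSum_prism_add_prism_faceSum`,
`sub_unhat_hat_mem_coboundaries`). This gives the linear isomorphism in each degree.

The product on the centralizer side is the cup product transported along this isomorphism, so the
algebra axioms come for free. The explicit formula is then a computation with representatives: pull
back, cup, restrict (`hat_cup_unhat_single`). -/

open HochschildGroup

noncomputable section

namespace HochschildGroup

/-! ### Homogeneous cochains on sequences -/

section Sequences

variable {V W k : Type*}

/-- The sequence without its term `i`. -/
def del (i : ℕ) (v : ℕ → V) : ℕ → V := fun j => if j < i then v j else v (j + 1)

/-- The sequence `a, v 0, v 1, …`. -/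
def consSeq (a : V) (v : ℕ → V) : ℕ → V
  | 0 => a
  | j + 1 => v j

/-- The alternating sum of the first `m` faces of a cochain. -/
def faceSum [Ring k] (m : ℕ) (F : (ℕ → V) → k) (v : ℕ → V) : k :=
  ∑ i ∈ Finset.range m, (-1 : k) ^ i * F (del i v)

/-- The homotopy between a homogeneous cochain and its pullback along `q`:
`∑ᵢ (-1)ⁱ F(v₀, …, vᵢ, q vᵢ, …, q vₘ₋₁)`. -/
def prism [Ring k] (q : V → V) : ℕ → ((ℕ → V) → k) → (ℕ → V) → k
  | 0, _, _ => 0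
  | m + 1, F, v => F (consSeq (v 0) (q ∘ v))
      - prism q m (fun w => F (consSeq (v 0) w)) (shift 1 v)

theorem consSeq_zero (a : V) (v : ℕ → V) : consSeq a v 0 = a := rfl

theorem shift_consSeq (a : V) (v : ℕ → V) : shift 1 (consSeq a v) = v := by
  funext j
  simp [shift, add_comm 1 j, consSeq]

theorem comp_shift (q : V → W) (n : ℕ) (v : ℕ → V) : q ∘ shift n v = shift n (q ∘ v) := rfl

theorem comp_consSeq (q : V → W) (a : V) (v : ℕ → V) :
    q ∘ consSeq a v = consSeq (q a) (q ∘ v) := by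
  funext j
  cases j <;> rfl

theorem del_comp (q : V → W) (i : ℕ) (v : ℕ → V) : del i (q ∘ v) = q ∘ del i v := by
  funext j
  simp only [del, Function.comp_apply]
  split_ifs <;> rfl

theorem del_zero (v : ℕ → V) : del 0 v = shift 1 v := by
  funext j
  simp [del, shift, add_comm]

theorem del_succ (i : ℕ) (v : ℕ → V) : del (i + 1) v = consSeq (v 0) (del i (shift 1 v)) := by
  funext j
  cases j with
  | zero => simp [del, consSeq]
  | succ j => simp [del, consSeq, shift, add_comm 1]

variable [CommRing k]

/-- Splitting off the face that omits v₀ leaves faces with v₀ frozen; this is the recursion that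
`prism` follows, and it drives every induction on the degree. -/
theorem faceSum_succ (m : ℕ) (F : (ℕ → V) → k) (v : ℕ → V) :
    faceSum (m + 1) F v
      = F (shift 1 v) - faceSum m (fun w => F (consSeq (v 0) w)) (shift 1 v) := by
  simp only [faceSum, Finset.sum_range_succ', pow_zero, one_mul, del_zero, del_succ, pow_succ]
  rw [add_comm, sub_eq_add_neg, ← Finset.sum_neg_distrib]
  simp

theorem faceSum_comp (q : V → W) (m : ℕ) (F : (ℕ → W) → k) (v : ℕ → V) :
    faceSum m (fun w => F (q ∘ w)) v = faceSum m F (q ∘ v) := by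
  simp [faceSum, del_comp]

theorem faceSum_sub (m : ℕ) (F F' : (ℕ → V) → k) (v : ℕ → V) :
    faceSum m (fun w => F w - F' w) v = faceSum m F v - faceSum m F' v := by
  simp [faceSum, mul_sub, Finset.sum_sub_distrib]

theorem faceSum_neg (m : ℕ) (F : (ℕ → V) → k) (v : ℕ → V) :
    faceSum m (fun w => -F w) v = -faceSum m F v := by
  simp [faceSum]

theorem prism_sub (q : V → V) (m : ℕ) (F F' : (ℕ → V) → k) (v : ℕ → V) :
    prism q m (fun w => F w - F' w) v = prism q m F v - prism q m F' v := by
  induction m generalizing F F' v with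
  | zero => simp [prism]
  | succ m ih => simp only [prism, ih]; ring

theorem prism_zero (q : V → V) (m : ℕ) (v : ℕ → V) : prism q m (fun _ => (0 : k)) v = 0 := by
  induction m generalizing v with
  | zero => rfl
  | succ m ih => simp [prism, ih]

/-- The sequence `v₀, …, vₘ₋₁, q vₘ, q vₘ₊₁, …`. -/
def mix (q : V → V) (m : ℕ) (v : ℕ → V) : ℕ → V := fun j => if j < m then v j else q (v j)

theorem mix_succ (q : V → V) (m : ℕ) (v : ℕ → V) :
    mix q (m + 1) v = consSeq (v 0) (mix q m (shift 1 v)) := by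
  funext j
  cases j with
  | zero => simp [mix, consSeq]
  | succ j => simp [mix, consSeq, shift, add_comm 1]

/-- The homotopy formula dP + Pd = q* − id. Sequences are infinite, so the last uncancelled term
still has q on its tail; `mix` records it, and it equals F v once F is local of degree m. -/
theorem faceSum_prism_add_prism_faceSum (q : V → V) (m : ℕ) (F : (ℕ → V) → k) (v : ℕ → V) :
    faceSum (m + 1) (prism q m F) v + prism q (m + 1) (faceSum (m + 2) F) v
      = F (q ∘ v) - F (mix q (m + 1) v) := by
  induction m generalizing F v with
  | zero =>
    have h0 : mix q 0 (shift 1 v) = q ∘ shift 1 v := by funext j; simp [mix]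
    simp only [mix_succ, h0, prism, faceSum_succ, shift_consSeq, zero_add]
    simp [faceSum, comp_shift, consSeq]
  | succ m ih =>
    have h := ih (fun w => F (consSeq (v 0) w)) (shift 1 v)
    rw [mix_succ, ← sub_eq_zero]
    rw [← sub_eq_zero] at h
    rw [← h, faceSum_succ, prism.eq_def q (m + 1 + 1)]
    simp only [faceSum_succ (m + 1 + 1)]
    simp only [shift_consSeq, prism_sub]
    have e1 : ∀ w : ℕ → V, (fun w => prism q (m + 1) F (consSeq (v 0) w)) w
        = F (consSeq (v 0) (q ∘ consSeq (v 0) w))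
          - prism q m (fun w => F (consSeq (v 0) w)) w := by
      intro w
      simp only [prism, shift_consSeq]
      rfl
    rw [funext e1, faceSum_sub]
    -- These are the faces in w of F(v₀, q v₀, q w); they cancel against faces of the leading term
    -- of the prism of dF.
    have e2 : ∀ w : ℕ → V, F (consSeq (v 0) (q ∘ consSeq (v 0) w))
        = (fun u => F (consSeq (v 0) (consSeq (q (v 0)) u))) (q ∘ w) := by
      intro w; rw [comp_consSeq]
    rw [funext e2, faceSum_comp q (m + 1) (fun u => F (consSeq (v 0) (consSeq (q (v 0)) u)))]
    simp only [consSeq_zero]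
    rw [faceSum_succ (m + 1) (fun w => F (consSeq (v 0) w)) (q ∘ v)]
    simp only [comp_shift, Function.comp_apply]
    ring

/-- The cochain depends on the terms `v₀, …, vₙ` only. -/
def IsLocal (n : ℕ) (F : (ℕ → V) → k) : Prop :=
  ∀ v w : ℕ → V, (∀ i ≤ n, v i = w i) → F v = F w

/-- The cochain vanishes on the sequences with two equal consecutive terms among `v₀, …, vₙ`. -/
def IsNormalized (n : ℕ) (F : (ℕ → V) → k) : Prop :=
  ∀ v : ℕ → V, (∃ i < n, v i = v (i + 1)) → F v = 0

theorem isLocal_prism (q : V → V) {m : ℕ} {F : (ℕ → V) → k} (hF : IsLocal (m + 1) F) :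
    IsLocal m (prism q (m + 1) F) := by
  induction m generalizing F with
  | zero =>
    intro v w h
    have h0 := h 0 le_rfl
    simp only [prism, h0, sub_zero]
    refine hF _ _ fun i hi => ?_
    interval_cases i <;> simp [consSeq, h0]
  | succ m ih =>
    intro v w h
    have h0 := h 0 (Nat.zero_le _)
    rw [prism.eq_def, prism.eq_def q (m + 1 + 1)]
    simp only [h0]
    congr 1
    · refine hF _ _ fun i hi => ?_
      cases i with
      | zero => rfl
      | succ i => simp [consSeq, h i (by omega)]
    · refine ih (F := fun u => F (consSeq (w 0) u)) (fun u u' hu => hF _ _ fun i hi => ?_) _ _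
        fun i hi => h _ (by omega)
      cases i with
      | zero => rfl
      | succ i => exact hu i (by omega)

/-- If vᵢ = vᵢ₊₁, each prism term contains either vᵢ, vᵢ₊₁ or q vᵢ, q vᵢ₊₁ in adjacent places, so
the terms vanish one by one. -/
theorem isNormalized_prism (q : V → V) {m : ℕ} {F : (ℕ → V) → k} (hF : IsNormalized (m + 1) F) :
    IsNormalized m (prism q (m + 1) F) := by
  induction m generalizing F with
  | zero => rintro v ⟨i, hi, -⟩; omega
  | succ m ih =>
    rintro v ⟨i, hi, hv⟩
    rw [prism.eq_def]
    simp only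
    rw [hF _ ⟨i + 1, by omega, by simp [consSeq, hv]⟩, zero_sub, neg_eq_zero]
    cases i with
    | zero =>
      simp only [prism]
      have hz : ∀ u, F (consSeq (v 0) (consSeq (shift 1 v 0) u)) = 0 := fun u =>
        hF _ ⟨0, by omega, hv⟩
      simp only [hz, prism_zero, sub_zero]
    | succ i =>
      refine ih (F := fun u => F (consSeq (v 0) u)) (fun u ⟨j, hj, hu⟩ =>
        hF _ ⟨j + 1, by omega, hu⟩) _ ⟨i, by omega, ?_⟩
      simpa [shift, add_comm 1] using hv

theorem prism_comp (q c : V → V) (hc : ∀ a, q (c a) = c (q a)) (m : ℕ) (F : (ℕ → V) → k)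
    (v : ℕ → V) : prism q m F (c ∘ v) = prism q m (fun w => F (c ∘ w)) v := by
  induction m generalizing F v with
  | zero => rfl
  | succ m ih =>
    simp only [prism, comp_consSeq, Function.comp_apply]
    have hq : q ∘ c ∘ v = c ∘ q ∘ v := by funext j; exact hc _
    rw [hq, ← comp_shift, ih]

theorem eq_comp_sub_faceSum_prism (q : V → V) {m : ℕ} {F : (ℕ → V) → k} (hF : IsLocal m F)
    (hd : ∀ v, faceSum (m + 2) F v = 0) (v : ℕ → V) :
    F v = F (q ∘ v) - faceSum (m + 1) (prism q m F) v := by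
  have h := faceSum_prism_add_prism_faceSum q m F v
  have h0 : faceSum (m + 2) F = fun _ => 0 := funext hd
  have h1 : F (mix q (m + 1) v) = F v := hF _ _ fun i hi => by
    simp [mix, Nat.lt_succ_of_le hi]
  rw [h0, prism_zero, h1] at h
  linear_combination h

end Sequences

/-! ### Homogeneous and inhomogeneous bar cochains. -/

section Quotients

variable {H : Type*} [Group H]

/-- The sequence of the quotients `vᵢ⁻¹ vᵢ₊₁`. -/
def quot (v : ℕ → H) : ℕ → H := fun i => (v i)⁻¹ * v (i + 1)

/-- The sequence `γ, γ g₁, γ g₁ g₂, …, γ g₁ ⋯ gₙ, γ g₁ ⋯ gₙ, …`. -/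
def path : {n : ℕ} → H → (Fin n → H) → ℕ → H
  | 0, γ, _ => fun _ => γ
  | _ + 1, γ, g => consSeq γ (path (γ * g 0) (Fin.tail g))

theorem path_zero {n : ℕ} (γ : H) (g : Fin n → H) : path γ g 0 = γ := by
  cases n <;> rfl

theorem tail_seg {V : Type*} (n : ℕ) (v : ℕ → V) : Fin.tail (seg (n + 1) v) = seg n (shift 1 v) := by
  funext i
  simp [Fin.tail, seg, shift, add_comm]

theorem quot_shift (n : ℕ) (v : ℕ → H) : quot (shift n v) = shift n (quot v) := rfl

theorem seg_quot_path {n : ℕ} (γ : H) (g : Fin n → H) : seg n (quot (path γ g)) = g := by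
  induction n generalizing γ with
  | zero => exact Subsingleton.elim _ _
  | succ n ih =>
    rw [← Fin.cons_self_tail (seg (n + 1) (quot (path γ g))), ← Fin.cons_self_tail g]
    congr 1
    · simp [seg, quot, path, consSeq, path_zero]
    · rw [tail_seg, ← quot_shift, path, shift_consSeq, ih]
      simp

/-- Only the indices up to n can agree, since `path` is constant afterwards; for local cochains this
is enough. -/
theorem path_seg_quot {n : ℕ} (v : ℕ → H) (i : ℕ) (hi : i ≤ n) :
    path (v 0) (seg n (quot v)) i = v i := by
  induction n generalizing v i with
  | zero => rw [Nat.le_zero.1 hi]; rfl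
  | succ n ih =>
    cases i with
    | zero => rfl
    | succ i =>
      have := ih (shift 1 v) i (by omega)
      rw [path, tail_seg]
      simp only [consSeq, seg, quot]
      simpa [shift, add_comm 1, quot_shift] using this

theorem path_mul {n : ℕ} (c γ : H) (g : Fin n → H) (i : ℕ) : path (c * γ) g i = c * path γ g i := by
  induction n generalizing γ i with
  | zero => rfl
  | succ n ih =>
    cases i with
    | zero => rfl
    | succ i => simp only [path, consSeq, mul_assoc, ih]

theorem path_last {n : ℕ} (γ : H) (g : Fin n → H) : path γ g n = γ * tupleProd g := by
  induction n generalizing γ with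
  | zero => simp [path, tupleProd]
  | succ n ih => simp [path, consSeq, ih, tupleProd, List.ofFn_succ, Fin.tail_def, mul_assoc]

theorem tupleProd_seg_quot (n : ℕ) (v : ℕ → H) :
    tupleProd (seg n (quot v)) = (v 0)⁻¹ * v n := by
  rw [eq_inv_mul_iff_mul_eq, ← path_last, path_seg_quot v n le_rfl]

theorem quot_del_zero (w : ℕ → H) : quot (del 0 w) = shift 1 (quot w) := by
  rw [del_zero, quot_shift]

theorem quot_del_succ (i : ℕ) (w : ℕ → H) : quot (del (i + 1) w) = contr i (quot w) := by
  funext j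
  simp only [quot, del, contr]
  rcases lt_trichotomy j i with h | h | h
  · simp [h, Nat.lt_succ_of_lt h]
  · simp [h]
  · simp [show ¬ j < i + 1 by omega, show ¬ j < i by omega, show ¬ j = i by omega]

theorem seg_quot_congr {n : ℕ} {v w : ℕ → H} (h : ∀ i ≤ n, v i = w i) :
    seg n (quot v) = seg n (quot w) := by
  funext i
  simp [seg, quot, h i (by omega), h (i + 1) (by omega)]

theorem quot_mul (c : H) (v : ℕ → H) : quot (fun i => c * v i) = quot v := by
  funext i
  simp [quot, mul_assoc]

variable {k M : Type*} [Field k] [AddCommGroup M] [Module k M]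

/-- The homogeneous cochain `w ↦ l(w₀ f(w₀⁻¹w₁, …, wₙ₋₁⁻¹wₙ) wₙ⁻¹)`. -/
def homogenize (L R : H → M →ₗ[k] M) (l : M →ₗ[k] k) (n : ℕ) (f : (Fin n → H) → M)
    (w : ℕ → H) : k :=
  l (L (w 0) (R (w n)⁻¹ (f (seg n (quot w)))))

theorem isLocal_homogenize (L R : H → M →ₗ[k] M) (l : M →ₗ[k] k) (n : ℕ) (f : (Fin n → H) → M) :
    IsLocal n (homogenize L R l n f) := by
  intro v w h
  rw [homogenize, homogenize, h 0 (Nat.zero_le n), h n le_rfl, seg_quot_congr h]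

/-- Omitting an inner vertex multiplies two adjacent quotients. Omitting w₀ or wₙ₊₁ yields the outer
terms, because w₀(w₀⁻¹w₁) = w₁ and (wₙ⁻¹wₙ₊₁)wₙ₊₁⁻¹ = wₙ⁻¹. -/
theorem homogenize_barD {L R : H → M →ₗ[k] M} (hL : ∀ g h y, L (g * h) y = L g (L h y))
    (hR : ∀ g h y, R (g * h) y = R h (R g y)) (hLR : ∀ g h y, L g (R h y) = R h (L g y))
    (l : M →ₗ[k] k) (n : ℕ) (f : (Fin n → H) → M) (w : ℕ → H) :
    homogenize L R l (n + 1) (barD L R n f) w = faceSum (n + 2) (homogenize L R l n f) w := by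
  rw [faceSum, Finset.sum_range_succ, Finset.sum_range_succ', homogenize, barD_seg]
  simp only [map_add, map_sum, map_smul, smul_eq_mul]
  rw [add_comm (∑ i ∈ Finset.range n, _)]
  congr 2
  · rw [← hLR, ← hL]
    simp only [homogenize, quot_del_zero, pow_zero, one_mul]
    simp [quot, del]
  · refine Finset.sum_congr rfl fun i hi => ?_
    have hi := Finset.mem_range.1 hi
    simp only [homogenize, quot_del_succ]
    simp [del, show ¬ n < i + 1 by omega]
  · rw [← hR]
    have h : ∀ i ≤ n, w i = del (n + 1) w i := fun i hi => by simp [del, Nat.lt_succ_of_le hi]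
    rw [← isLocal_homogenize L R l n f _ _ h]
    simp [homogenize, quot, mul_assoc]

end Quotients

/-! ### Hochschild cochains as families of homogeneous cochains -/

section Homogeneous

variable {k G : Type*} [Field k] [Group G]

/-! ### The retraction of G onto a centralizer. -/

theorem centPart_mul_cosetRep (D : ClassData G) (x : D.X) (g : G) :
    (D.centPart x g : G) * D.cosetRep x g = g :=
  (D.isComplement x).equiv_fst_mul_equiv_snd g

theorem cosetRep_mem (D : ClassData G) (x : D.X) (g : G) : D.cosetRep x g ∈ D.S x :=
  ((D.isComplement x).equiv g).2.2

theorem centPart_mul (D : ClassData G) (x : D.X) (c : Cent (x : G)) (g : G) :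
    D.centPart x (c * g) = c * D.centPart x g := by
  have := (D.isComplement x).equiv_mul_left (H := Cent (x : G)) c g
  exact congrArg Prod.fst this

theorem centPart_of_mem (D : ClassData G) (x : D.X) {γ : G} (hγ : γ ∈ D.S x) :
    D.centPart x γ = 1 :=
  (D.isComplement x).equiv_fst_eq_one_of_mem_of_one_mem (Cent (x : G)).one_mem hγ

/-- The choice 1 ∈ S x makes hγ ↦ h a retraction; `hat_unhat` rests on this. -/
theorem centPart_coe (D : ClassData G) (x : D.X) (c : Cent (x : G)) : D.centPart x (c : G) = c := by
  simpa [centPart_of_mem D x (D.one_mem x)] using centPart_mul D x c 1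

theorem cosetRep_of_mem (D : ClassData G) (x : D.X) {γ : G} (hγ : γ ∈ D.S x) :
    D.cosetRep x γ = γ := by
  simpa [centPart_of_mem D x hγ] using centPart_mul_cosetRep D x γ

theorem cosetRep_mul (D : ClassData G) (x : D.X) (c : Cent (x : G)) (g : G) :
    D.cosetRep x (c * g) = D.cosetRep x g := by
  have := (D.isComplement x).equiv_mul_left (H := Cent (x : G)) c g
  exact congrArg (fun p => (p.2 : G)) this

/-- Telescoping the defining relations gives γ g₁ ⋯ gⱼ = (h₁ ⋯ hⱼ) γ' with γ' ∈ S x, so h₁ ⋯ hⱼ is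
the image of the j-th vertex under the retraction. -/
theorem hSeq_eq (D : ClassData G) (x : D.X) {n : ℕ} {γ : G} (hγ : γ ∈ D.S x) (g : Fin n → G) :
    D.hSeq x γ g = seg n (quot (D.centPart x ∘ path γ g)) := by
  induction n generalizing γ with
  | zero => exact Subsingleton.elim _ _
  | succ n ih =>
    rw [ClassData.hSeq, ← Fin.cons_self_tail (seg (n + 1) _), tail_seg, ← quot_shift, ← comp_shift,
      path, shift_consSeq, ih (cosetRep_mem D x _)]
    congr 1
    · simp [seg, quot, consSeq, path_zero, centPart_of_mem D x hγ]
    -- The remaining path starts at γ g₁ = cγ' with c ∈ C_G(x). Replacing this start by γ' removes a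
    -- common left factor c from the retracted vertices, which their quotients do not see.
    · conv_rhs => rw [← centPart_mul_cosetRep D x (γ * g 0)]
      refine congrArg (seg n) ?_
      rw [← quot_mul (D.centPart x (γ * g 0))]
      congr 1
      funext i
      simp only [Function.comp_apply, path_mul, centPart_mul]

/-! ### Hochschild cochains in reversed homogeneous form. -/

/-- The coefficient of `x`, as a linear form. -/
def coeffAt (k : Type*) {G : Type*} [Field k] (x : G) : MonoidAlgebra k G →ₗ[k] k where
  toFun a := a.coeff x
  map_add' _ _ := rfl
  map_smul' _ _ := rfl

theorem coeffAt_apply {G : Type*} (x : G) (a : MonoidAlgebra k G) : coeffAt k x a = a.coeff x := rfl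

/-- The sequence `vₙ, …, v₀, v₀, …`. -/
def rev {V : Type*} (n : ℕ) (v : ℕ → V) : ℕ → V := fun j => v (n - j)

theorem revInv_seg_quot (n : ℕ) (v : ℕ → G) :
    revInv (seg n (quot v)) = seg n (quot (rev n v)) := by
  funext i
  simp only [revInv, seg, quot, rev, mul_inv_rev, inv_inv, Fin.val_rev]
  rw [show n - (i + 1) + 1 = n - (i : ℕ) by omega]

theorem revInv_revInv {n : ℕ} (g : Fin n → G) : revInv (revInv g) = g := by
  funext i
  simp [revInv]

theorem tupleProd_revInv {n : ℕ} (g : Fin n → G) : tupleProd (revInv g) = (tupleProd g)⁻¹ := by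
  rw [← seg_quot_path 1 g, revInv_seg_quot, tupleProd_seg_quot, tupleProd_seg_quot]
  simp [rev]

/-- The coefficient of `x` in
`(-1)^{n(n+1)/2} vₙ φ(vₙ⁻¹vₙ₋₁, …, v₁⁻¹v₀) v₀⁻¹`. -/
def hochschildHomog (x : G) (n : ℕ) (φ : (Fin n → G) → MonoidAlgebra k G) (v : ℕ → G) : k :=
  (-1 : k) ^ (n * (n + 1) / 2) *
    homogenize (leftMul k) (rightMul k) (coeffAt k x) n φ (rev n v)

theorem hochschildHomog_apply (x : G) (n : ℕ) (φ : (Fin n → G) → MonoidAlgebra k G) (v : ℕ → G) :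
    hochschildHomog x n φ v = (-1 : k) ^ (n * (n + 1) / 2) *
      (φ (revInv (seg n (quot v)))).coeff ((v n)⁻¹ * x * v 0) := by
  simp [hochschildHomog, homogenize, coeffAt_apply, leftMul, rightMul, rev, revInv_seg_quot,
    MonoidAlgebra.coeff_mul_single_apply, MonoidAlgebra.coeff_single_mul_apply, mul_assoc]

theorem sign_succ (n : ℕ) : (-1 : k) ^ ((n + 1) * (n + 1 + 1) / 2)
    = (-1 : k) ^ (n * (n + 1) / 2) * (-1 : k) ^ (n + 1) := by
  rw [← pow_add]
  congr 1
  rw [show (n + 1) * (n + 1 + 1) = n * (n + 1) + (n + 1) * 2 by ring,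
    Nat.add_mul_div_right _ _ two_pos]

theorem sign_mul_self (n : ℕ) : (-1 : k) ^ n * (-1 : k) ^ n = 1 := by
  rw [← mul_pow]; simp

/-- Reversal exchanges the faces i and n + 1 − i, whence the sign (-1)ⁿ⁺¹; by `sign_succ` this is
the ratio of consecutive signs (-1)^{n(n+1)/2}. -/
theorem faceSum_rev {V : Type*} (n : ℕ) {F : (ℕ → V) → k} (hF : IsLocal n F) (v : ℕ → V) :
    faceSum (n + 2) (fun w => F (rev n w)) v
      = (-1 : k) ^ (n + 1) * faceSum (n + 2) F (rev (n + 1) v) := by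
  rw [faceSum, faceSum, ← Finset.sum_range_reflect, Finset.mul_sum]
  refine Finset.sum_congr rfl fun i hi => ?_
  have hi := Finset.mem_range.1 hi
  rw [← mul_assoc, ← pow_add]
  congr 1
  · rw [show n + 1 + i = (n + 2 - 1 - i) + 2 * i by omega, pow_add, pow_mul]
    simp
  · refine hF _ _ fun j hj => ?_
    simp only [rev, del]
    split_ifs <;> first | omega | (congr 1; omega)

theorem hochschildHomog_barD (x : G) (n : ℕ) (φ : (Fin n → G) → MonoidAlgebra k G) (v : ℕ → G) :
    hochschildHomog x (n + 1) (barD (leftMul k) (rightMul k) n φ) v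
      = faceSum (n + 2) (hochschildHomog x n φ) v := by
  rw [hochschildHomog, homogenize_barD, sign_succ, mul_assoc,
    ← faceSum_rev n (isLocal_homogenize _ _ _ _ _)]
  · simp only [hochschildHomog, faceSum, Finset.mul_sum]
    exact Finset.sum_congr rfl fun _ _ => by ring
  · intro g h y
    simp [leftMul, ← mul_assoc, MonoidAlgebra.single_mul_single]
  · intro g h y
    simp [rightMul, mul_assoc, MonoidAlgebra.single_mul_single]
  · intro g h y
    simp [leftMul, rightMul, mul_assoc]

theorem isLocal_hochschildHomog (x : G) (n : ℕ) (φ : (Fin n → G) → MonoidAlgebra k G) :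
    IsLocal n (hochschildHomog x n φ) := by
  intro v w h
  rw [hochschildHomog_apply, hochschildHomog_apply, h 0 (Nat.zero_le n), h n le_rfl,
    seg_quot_congr h]

theorem mem_cent {x c : G} : c ∈ Cent x ↔ c * x = x * c := by
  rw [Subgroup.mem_centralizer_singleton_iff]

/-- Translating the vertices by c conjugates the value in kG by c, which preserves the coefficient
of x when c commutes with x. -/
theorem hochschildHomog_mul {x c : G} (hc : c ∈ Cent x) (n : ℕ)
    (φ : (Fin n → G) → MonoidAlgebra k G) (v : ℕ → G) :
    hochschildHomog x n φ (fun i => c * v i) = hochschildHomog x n φ v := by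
  rw [hochschildHomog_apply, hochschildHomog_apply, quot_mul]
  congr 2
  have := mem_cent.1 hc
  rw [mul_inv_rev, mul_assoc, mul_assoc, mul_assoc, ← mul_assoc x, ← this]
  group

theorem isNormalized_hochschildHomog (x : G) {n : ℕ} {φ : (Fin n → G) → MonoidAlgebra k G}
    (hφ : φ ∈ normalizedCochains k G (MonoidAlgebra k G) n) :
    IsNormalized n (hochschildHomog x n φ) := by
  rintro v ⟨i, hi, hv⟩
  rw [hochschildHomog_apply, hφ _ ⟨Fin.rev ⟨i, hi⟩, by simp [revInv, seg, quot, hv]⟩]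
  simp

/-! ### Hochschild cochains as families of invariant cochains. -/

theorem exists_class (D : ClassData G) (w : G) :
    ∃ x : D.X, ∃ γ ∈ D.S x, γ⁻¹ * (x : G) * γ = w := by
  obtain ⟨x, ⟨hx, hc⟩, -⟩ := D.existsUnique_conj w
  obtain ⟨c, hc⟩ := isConj_iff.1 hc
  -- With w = c x c⁻¹ and c⁻¹ = hγ, the factor h commutes with x and drops out of the conjugate.
  refine ⟨⟨x, hx⟩, _, cosetRep_mem D ⟨x, hx⟩ c⁻¹, ?_⟩
  set h := D.centPart ⟨x, hx⟩ c⁻¹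
  have h1 := centPart_mul_cosetRep D ⟨x, hx⟩ c⁻¹
  have h2 : D.cosetRep ⟨x, hx⟩ c⁻¹ = (h : G)⁻¹ * c⁻¹ := eq_inv_mul_of_mul_eq h1
  have h3 : (h : G) * x = x * h := mem_cent.1 h.2
  rw [h2, mul_inv_rev, inv_inv, inv_inv, ← hc, mul_assoc c, h3]
  group

/-- Conjugate representatives coincide, and γ⁻¹xγ = η⁻¹xη puts γη⁻¹ in C_G(x), so γ and η represent
the same right coset. -/
theorem class_unique (D : ClassData G) {x y : D.X} {γ η : G} (hγ : γ ∈ D.S x) (hη : η ∈ D.S y)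
    (h : γ⁻¹ * (x : G) * γ = η⁻¹ * (y : G) * η) : (⟨x, γ⟩ : D.X × G) = ⟨y, η⟩ := by
  have hxy : x = y := by
    have hx : IsConj (x : G) (γ⁻¹ * x * γ) := isConj_iff.2 ⟨γ⁻¹, by simp⟩
    have hy : IsConj (y : G) (γ⁻¹ * x * γ) := isConj_iff.2 ⟨η⁻¹, by simp [h]⟩
    exact Subtype.ext ((D.existsUnique_conj _).unique ⟨x.2, hx⟩ ⟨y.2, hy⟩)
  subst hxy
  have hc : γ * η⁻¹ ∈ Cent (x : G) := by
    rw [mem_cent]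
    have : (x : G) = γ * (η⁻¹ * x * η) * γ⁻¹ := by rw [← h]; group
    conv_rhs => rw [this]
    group
  have := cosetRep_mul D x ⟨_, hc⟩ η
  simp only [inv_mul_cancel_right, cosetRep_of_mem D x hγ, cosetRep_of_mem D x hη] at this
  rw [this]

theorem eq_of_hochschildHomog_eq (D : ClassData G) {n : ℕ}
    {φ φ' : (Fin n → G) → MonoidAlgebra k G}
    (h : ∀ (x : D.X) v, hochschildHomog (x : G) n φ v = hochschildHomog (x : G) n φ' v) :
    φ = φ' := by
  funext g
  ext w
  -- On the path from γ with steps gₙ⁻¹, …, g₁⁻¹, the coefficient of φ(g) that is read off sits at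
  -- vₙ⁻¹ x v₀; this choice of x and γ makes it w.
  obtain ⟨x, γ, -, hγ⟩ := exists_class D (tupleProd (revInv g) * w)
  have := h x (path γ (revInv g))
  rw [hochschildHomog_apply, hochschildHomog_apply, seg_quot_path, revInv_revInv, path_last,
    path_zero] at this
  have e : (γ * tupleProd (revInv g))⁻¹ * (x : G) * γ = w := by
    rw [mul_inv_rev, mul_assoc, mul_assoc, ← mul_assoc γ⁻¹, hγ, inv_mul_cancel_left]
  rw [e] at this
  exact mul_left_cancel₀ (pow_ne_zero _ (by simp)) this

/-- The Hochschild cochain attached to a family of homogeneous cochains. -/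
def ofHomog (D : ClassData G) (n : ℕ) (F : D.X → (ℕ → G) → k) (g : Fin n → G) :
    MonoidAlgebra k G :=
  (-1 : k) ^ (n * (n + 1) / 2) • (MonoidAlgebra.single (tupleProd g) (1 : k) *
    ∑ x : D.X, ∑ γ ∈ D.S x,
      MonoidAlgebra.single (γ⁻¹ * (x : G) * γ) (F x (path γ (revInv g))))

theorem coeff_sum_single (D : ClassData G) (f : D.X → G → k) {x : D.X} {γ : G} (hγ : γ ∈ D.S x) :
    (∑ y : D.X, ∑ η ∈ D.S y, MonoidAlgebra.single (η⁻¹ * (y : G) * η) (f y η)).coeff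
      (γ⁻¹ * (x : G) * γ) = f x γ := by
  classical
  simp only [MonoidAlgebra.coeff_sum, Finsupp.finsetSum_apply, MonoidAlgebra.coeff_single,
    Finsupp.single_apply]
  rw [Finset.sum_eq_single x, Finset.sum_eq_single γ]
  · simp
  · intro η hη hne
    rw [if_neg]
    intro h
    exact hne (congrArg Prod.snd (class_unique D hη hγ h))
  · exact fun h => absurd hγ h
  · intro y _ hne
    refine Finset.sum_eq_zero fun η hη => ?_
    rw [if_neg]
    intro h
    exact hne (congrArg Prod.fst (class_unique D hη hγ h))
  · simp

/-- Write v₀ = hγ. The coefficient extracted is that of γ⁻¹xγ, which only the pair (x, γ)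
contributes, giving F on the path from γ; translation by h ∈ C_G(x) then restores v. -/
theorem hochschildHomog_ofHomog (D : ClassData G) {n : ℕ} {F : D.X → (ℕ → G) → k} {x : D.X}
    (hF : IsLocal n (F x)) (hc : ∀ c ∈ Cent (x : G), ∀ v, F x (fun i => c * v i) = F x v)
    (v : ℕ → G) : hochschildHomog (x : G) n (ofHomog D n F) v = F x v := by
  set h := D.centPart x (v 0)
  set γ := D.cosetRep x (v 0)
  have hγ : γ ∈ D.S x := cosetRep_mem D x (v 0)
  have h0 : (h : G) * γ = v 0 := centPart_mul_cosetRep D x (v 0)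
  have hx : (h : G) * x = x * h := mem_cent.1 h.2
  have e : tupleProd (seg n (quot v)) * ((v n)⁻¹ * x * v 0) = γ⁻¹ * (x : G) * γ := by
    rw [tupleProd_seg_quot, ← h0]
    have : (x : G) * h = h * x := hx.symm
    calc _ = γ⁻¹ * (h : G)⁻¹ * (x * h) * γ := by group
      _ = _ := by rw [this]; group
  rw [hochschildHomog_apply, ofHomog, tupleProd_revInv, revInv_revInv,
    MonoidAlgebra.coeff_smul_apply, MonoidAlgebra.coeff_single_mul_apply, inv_inv, e,
    coeff_sum_single D _ hγ, one_mul, smul_eq_mul, ← mul_assoc, sign_mul_self, one_mul,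
    ← hc h h.2]
  refine hF _ _ fun i hi => ?_
  rw [← path_mul, h0, path_seg_quot v i hi]

theorem ofHomog_mem_normalizedCochains (D : ClassData G) {n : ℕ} {F : D.X → (ℕ → G) → k}
    (hF : ∀ x, IsNormalized n (F x)) :
    ofHomog D n F ∈ normalizedCochains k G (MonoidAlgebra k G) n := by
  rintro g ⟨i, hi⟩
  have h : ∀ x γ, F x (path γ (revInv g)) = 0 := fun x γ => by
    refine hF x _ ⟨i.rev, i.rev.2, ?_⟩
    have := congrFun (seg_quot_path γ (revInv g)) i.rev
    simp only [seg, quot, revInv, Fin.rev_rev, hi, inv_one] at this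
    exact inv_mul_eq_one.1 this
  simp [ofHomog, h]

end Homogeneous

/-! ### The comparison maps on cochains -/

section Trivial

variable {k H : Type*} [Group H]

/-- The homogeneous cochain of a cochain with trivial coefficients. -/
def trivHomog {n : ℕ} (ψ : (Fin n → H) → k) (v : ℕ → H) : k :=
  ψ (seg n (quot v))

theorem trivHomog_barD [Field k] {n : ℕ} (ψ : (Fin n → H) → k) (v : ℕ → H) :
    trivHomog (barD (fun _ => LinearMap.id) (fun _ => (LinearMap.id : k →ₗ[k] k)) n ψ) v
      = faceSum (n + 2) (trivHomog ψ) v :=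
  homogenize_barD (L := fun _ : H => (LinearMap.id : k →ₗ[k] k)) (R := fun _ => LinearMap.id)
    (fun _ _ _ => rfl) (fun _ _ _ => rfl) (fun _ _ _ => rfl) LinearMap.id n ψ v

theorem isLocal_trivHomog {n : ℕ} (ψ : (Fin n → H) → k) :
    IsLocal n (trivHomog ψ) := fun v w h => by
  rw [trivHomog, trivHomog, seg_quot_congr h]

theorem eq_of_trivHomog_eq {n : ℕ} {ψ ψ' : (Fin n → H) → k}
    (h : ∀ v, trivHomog ψ v = trivHomog ψ' v) : ψ = ψ' := by
  funext g
  simpa [trivHomog, seg_quot_path] using h (path 1 g)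

theorem isNormalized_trivHomog [Field k] {n : ℕ} {ψ : (Fin n → H) → k}
    (hψ : ψ ∈ normalizedCochains k H k n) : IsNormalized n (trivHomog ψ) := by
  rintro v ⟨i, hi, hv⟩
  exact hψ _ ⟨⟨i, hi⟩, by simp [seg, quot, hv]⟩

end Trivial

/-! ### Restriction to the centralizers, and pullback from them. -/

section Comparison

variable {k G : Type*} [Field k] [Group G] (D : ClassData G)

theorem trivHomog_hat (x : G) {n : ℕ} (φ : (Fin n → G) → MonoidAlgebra k G) (c : ℕ → Cent x) :
    trivHomog (hat φ x) c = hochschildHomog x n φ (fun i => (c i : G)) := by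
  have e : (fun i => ((seg n (quot c) i : Cent x) : G)) = seg n (quot fun i => (c i : G)) := by
    funext i; simp [seg, quot]
  have hx : (c 0 : G) * x = x * c 0 := mem_cent.1 (c 0).2
  rw [trivHomog, hat, hochschildHomog_apply, e, tupleProd_seg_quot,
    MonoidAlgebra.coeff_smul_apply, MonoidAlgebra.coeff_single_mul_apply, smul_eq_mul, one_mul]
  congr 2
  rw [mul_assoc _ x, ← hx]
  group

theorem hat_barD (x : G) {n : ℕ} (φ : (Fin n → G) → MonoidAlgebra k G) :
    hat (barD (leftMul k) (rightMul k) n φ) x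
      = barD (fun _ : Cent x => LinearMap.id) (fun _ => (LinearMap.id : k →ₗ[k] k)) n (hat φ x) := by
  refine eq_of_trivHomog_eq fun c => ?_
  rw [trivHomog_hat, hochschildHomog_barD, trivHomog_barD]
  have : trivHomog (hat φ x) = fun c : ℕ → Cent x => hochschildHomog x n φ (Subtype.val ∘ c) :=
    funext fun c => trivHomog_hat x φ c
  rw [this, faceSum_comp]
  rfl

theorem hat_mem_normalizedCochains (x : G) {n : ℕ} {φ : (Fin n → G) → MonoidAlgebra k G}
    (hφ : φ ∈ normalizedCochains k G (MonoidAlgebra k G) n) :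
    hat φ x ∈ normalizedCochains k (Cent x) k n := by
  rintro h ⟨i, hi⟩
  have : φ (revInv fun i => (h i : G)) = 0 := hφ _ ⟨i.rev, by simp [revInv, hi]⟩
  simp [hat, this]

theorem unhat_eq_ofHomog {n : ℕ} (ψ : (x : D.X) → (Fin n → Cent (x : G)) → k) :
    unhat D ψ = ofHomog D n fun x v => trivHomog (ψ x) (D.centPart x ∘ v) := by
  funext g
  rw [unhat, ofHomog]
  congr 2
  refine Finset.sum_congr rfl fun x _ => Finset.sum_congr rfl fun γ hγ => ?_
  rw [hSeq_eq D x hγ, trivHomog]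

theorem hochschildHomog_unhat {n : ℕ} (ψ : (x : D.X) → (Fin n → Cent (x : G)) → k) (x : D.X)
    (v : ℕ → G) :
    hochschildHomog (x : G) n (unhat D ψ) v = trivHomog (ψ x) (D.centPart x ∘ v) := by
  rw [unhat_eq_ofHomog, hochschildHomog_ofHomog (x := x)]
  · exact fun v w h => isLocal_trivHomog _ _ _ fun i hi => by simp [h i hi]
  · intro c hc v
    have : (D.centPart x ∘ fun i => c * v i) = fun i => ⟨c, hc⟩ * (D.centPart x ∘ v) i :=
      funext fun i => centPart_mul D x ⟨c, hc⟩ (v i)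
    rw [this, trivHomog, trivHomog, quot_mul]

/-- In homogeneous form `unhat` is pullback along a map of vertices, and such pullbacks commute with
faces. -/
theorem unhat_barD {n : ℕ} (ψ : (x : D.X) → (Fin n → Cent (x : G)) → k) :
    unhat D (fun x : D.X => barD (fun _ : Cent (x : G) => LinearMap.id)
      (fun _ => (LinearMap.id : k →ₗ[k] k)) n (ψ x))
      = barD (leftMul k) (rightMul k) n (unhat D ψ) := by
  refine eq_of_hochschildHomog_eq D fun x v => ?_
  rw [hochschildHomog_barD, hochschildHomog_unhat, trivHomog_barD, ← faceSum_comp]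
  simp only [funext (hochschildHomog_unhat D ψ x)]

theorem unhat_mem_normalizedCochains {n : ℕ} {ψ : (x : D.X) → (Fin n → Cent (x : G)) → k}
    (hψ : ∀ x : D.X, ψ x ∈ normalizedCochains k (Cent (x : G)) k n) :
    unhat D ψ ∈ normalizedCochains k G (MonoidAlgebra k G) n := by
  rw [unhat_eq_ofHomog]
  refine ofHomog_mem_normalizedCochains D fun x v ⟨i, hi, hv⟩ => ?_
  exact isNormalized_trivHomog (hψ x) _ ⟨i, hi, by simp [hv]⟩

theorem hat_unhat {n : ℕ} (ψ : (x : D.X) → (Fin n → Cent (x : G)) → k) (x : D.X) :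
    hat (unhat D ψ) (x : G) = ψ x := by
  refine eq_of_trivHomog_eq fun c => ?_
  rw [trivHomog_hat, hochschildHomog_unhat]
  congr 1
  funext i
  exact centPart_coe D x (c i)

theorem unhat_zero {n : ℕ} :
    unhat D (fun x => (0 : (Fin n → Cent (x : G)) → k)) = 0 := by
  funext g
  simp [unhat]

/-- For the retraction q, the homogeneous form of `unhat` of `hat` is F ∘ q. The prism is again
local, normalized and C_G(x)-invariant, so it comes from a normalized Hochschild cochain. -/
theorem sub_unhat_hat_mem_coboundaries {n : ℕ} {φ : (Fin n → G) → MonoidAlgebra k G}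
    (hφ : φ ∈ hochschildCocycles k G n) :
    φ - unhat D (fun x => hat φ (x : G)) ∈ coboundaries (leftMul k) (rightMul k) n := by
  have hd : ∀ (x : D.X) v, faceSum (n + 2) (hochschildHomog (x : G) n φ) v = 0 := fun x v => by
    rw [← hochschildHomog_barD, hφ.2, hochschildHomog_apply]
    simp
  have key : ∀ (x : D.X) v, hochschildHomog (x : G) n φ v
      = hochschildHomog (x : G) n (unhat D fun x => hat φ (x : G)) v
        - faceSum (n + 1) (prism (fun g => (D.centPart x g : G)) n
            (hochschildHomog (x : G) n φ)) v := fun x v => by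
    rw [hochschildHomog_unhat, trivHomog_hat,
      eq_comp_sub_faceSum_prism (fun g => (D.centPart x g : G))
        (isLocal_hochschildHomog (x : G) n φ) (hd x) v]
    rfl
  cases n with
  | zero =>
    -- There are no coboundaries in degree 0, so equality must hold exactly; it does, because the
    -- prism in degree 0 is an empty sum.
    rw [coboundaries, Submodule.mem_bot, sub_eq_zero]
    refine eq_of_hochschildHomog_eq D fun x v => ?_
    rw [key x v]
    simp [faceSum, prism]
  | succ m =>
    -- The minus sign comes from F − F ∘ q = −d(prism F) for a cocycle F.
    let F : D.X → (ℕ → G) → k := fun x v =>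
      -prism (fun g => (D.centPart x g : G)) (m + 1) (hochschildHomog (x : G) (m + 1) φ) v
    refine ⟨ofHomog D m F, ofHomog_mem_normalizedCochains D fun x v hv => ?_, ?_⟩
    · exact neg_eq_zero.2 (isNormalized_prism _ (isNormalized_hochschildHomog (x : G) hφ.1) v hv)
    · refine eq_of_hochschildHomog_eq D fun x v => ?_
      have hF : ∀ w, hochschildHomog (x : G) m (ofHomog D m F) w = F x w := fun w => by
        refine hochschildHomog_ofHomog D (fun v w h => ?_) (fun c hc v => ?_) w
        · exact congrArg Neg.neg (isLocal_prism _ (isLocal_hochschildHomog (x : G) (m + 1) φ) v w h)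
        · refine congrArg Neg.neg ((prism_comp _ (fun a => c * a) (fun a => ?_) _ _ v).trans ?_)
          · exact congrArg Subtype.val (centPart_mul D x ⟨c, hc⟩ a)
          · congr 1
            exact funext fun w => hochschildHomog_mul hc (m + 1) φ w
      rw [hochschildHomog_barD, funext hF, faceSum_neg]
      have hs : hochschildHomog (x : G) (m + 1) (φ - unhat D fun x => hat φ (x : G)) v
          = hochschildHomog (x : G) (m + 1) φ v
            - hochschildHomog (x : G) (m + 1) (unhat D fun x => hat φ (x : G)) v := by
        simp [hochschildHomog_apply, mul_sub]
      rw [hs, key x v]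
      ring

end Comparison

end HochschildGroup


/-! ### Transport of graded algebra structures -/

namespace DirectSum

open GradedMonoid

theorem mapRange_linearEquiv_of {ι R : Type*} [Semiring R] {A B : ι → Type*}
    [∀ i, AddCommMonoid (A i)] [∀ i, AddCommMonoid (B i)] [∀ i, Module R (A i)]
    [∀ i, Module R (B i)] [DecidableEq ι] (e : ∀ i, A i ≃ₗ[R] B i) (i : ι) (a : A i) :
    DFinsupp.mapRange.linearEquiv e (DirectSum.of A i a) = DirectSum.of B i (e i a) :=
  DFinsupp.mapRange_single (hf := fun i => map_zero (e i))

variable {ι R : Type*} [CommSemiring R] {A B : ι → Type*}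
  [∀ i, AddCommMonoid (A i)] [∀ i, AddCommMonoid (B i)] [∀ i, Module R (A i)]
  [∀ i, Module R (B i)]

/-- The map of graded monoids given by isomorphisms of the graded pieces. -/
def gradedMap (e : ∀ i, A i ≃ₗ[R] B i) (a : GradedMonoid A) : GradedMonoid B :=
  GradedMonoid.mk a.1 (e a.1 a.2)

theorem gradedMap_surjective (e : ∀ i, A i ≃ₗ[R] B i) : Function.Surjective (gradedMap e) := by
  rintro ⟨i, b⟩
  exact ⟨GradedMonoid.mk i ((e i).symm b), 
    congrArg (GradedMonoid.mk i) (LinearEquiv.apply_symm_apply (e i) b)⟩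

variable [AddMonoid ι] [GSemiring A]

/-- The graded product transported along isomorphisms of the graded pieces. -/
abbrev transportGMul (e : ∀ i, A i ≃ₗ[R] B i) : GMul B where
  mul {i j} a b := e (i + j) (GMul.mul ((e i).symm a) ((e j).symm b))

/-- The graded unit transported along isomorphisms of the graded pieces. -/
abbrev transportGOne (e : ∀ i, A i ≃ₗ[R] B i) : GOne B where
  one := e 0 GOne.one

/-- Identities such as associativity compare elements of the propositionally equal degrees (i + j) +
l and i + (j + l). In `GradedMonoid` they are plain equations, which pass along a surjective
multiplicative map. -/
theorem gradedMap_mul (e : ∀ i, A i ≃ₗ[R] B i) (a b : GradedMonoid A) :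
    letI := transportGMul e
    gradedMap e (a * b) = gradedMap e a * gradedMap e b := by
  obtain ⟨i, a⟩ := a
  obtain ⟨j, b⟩ := b
  change GradedMonoid.mk (i + j) (e (i + j) (GMul.mul a b)) = GradedMonoid.mk (i + j)
    (e (i + j) (GMul.mul ((e i).symm (e i a)) ((e j).symm (e j b))))
  rw [LinearEquiv.symm_apply_apply, LinearEquiv.symm_apply_apply]

/-- The graded semiring structure transported along isomorphisms of the graded pieces. -/
abbrev transportGSemiring (e : ∀ i, A i ≃ₗ[R] B i) : GSemiring B :=
  letI := transportGMul e
  letI := transportGOne e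
  { transportGMul e, transportGOne e with
    mul_zero := fun a => by simp [GMul.mul, GNonUnitalNonAssocSemiring.mul_zero]
    zero_mul := fun a => by simp [GMul.mul, GNonUnitalNonAssocSemiring.zero_mul]
    mul_add := fun a b c => by simp [GMul.mul, GNonUnitalNonAssocSemiring.mul_add]
    add_mul := fun a b c => by simp [GMul.mul, GNonUnitalNonAssocSemiring.add_mul]
    one_mul := fun b => by
      obtain ⟨a, rfl⟩ := gradedMap_surjective e b
      exact (gradedMap_mul e 1 a).symm.trans (congrArg (gradedMap e) (one_mul a))
    mul_one := fun b => by
      obtain ⟨a, rfl⟩ := gradedMap_surjective e b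
      exact (gradedMap_mul e a 1).symm.trans (congrArg (gradedMap e) (mul_one a))
    mul_assoc := fun a b c => by
      obtain ⟨a, rfl⟩ := gradedMap_surjective e a
      obtain ⟨b, rfl⟩ := gradedMap_surjective e b
      obtain ⟨c, rfl⟩ := gradedMap_surjective e c
      rw [← gradedMap_mul, ← gradedMap_mul, ← gradedMap_mul, ← gradedMap_mul, mul_assoc]
    natCast := fun n => e 0 (GSemiring.natCast n)
    natCast_zero := by simp [GSemiring.natCast_zero]
    natCast_succ := fun n =>
      (congrArg (e 0) (GSemiring.natCast_succ n)).trans (map_add (e 0) _ _) }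

variable [GAlgebra R A]

/-- The graded algebra structure transported along isomorphisms of the graded pieces. -/
abbrev transportGAlgebra (e : ∀ i, A i ≃ₗ[R] B i) :
    letI := transportGSemiring e
    GAlgebra R B :=
  letI := transportGSemiring e
  { toFun := (e 0).toLinearMap.toAddMonoidHom.comp (GAlgebra.toFun (A := A))
    map_one := congrArg (e 0) GAlgebra.map_one
    map_mul := fun r s => (congrArg (gradedMap e) (GAlgebra.map_mul (A := A) r s)).trans
      (gradedMap_mul e (GradedMonoid.mk 0 (GAlgebra.toFun r)) (GradedMonoid.mk 0 (GAlgebra.toFun s)))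
    commutes := fun r x => by
      obtain ⟨a, rfl⟩ := gradedMap_surjective e x
      exact (gradedMap_mul e _ a).symm.trans
        ((congrArg (gradedMap e) (GAlgebra.commutes (A := A) r a)).trans (gradedMap_mul e a _))
    smul_def := fun r x => by
      obtain ⟨a, rfl⟩ := gradedMap_surjective e x
      have h : r • gradedMap e a = gradedMap e (r • a) :=
        congrArg (GradedMonoid.mk a.1) (map_smul (e a.1) r a.2).symm
      exact h.trans ((congrArg (gradedMap e) (GAlgebra.smul_def (A := A) r a)).trans
        (gradedMap_mul e _ a)) }

/-- The isomorphism of algebras given by isomorphisms of the graded pieces along which the structure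
is transported. -/
def transportAlgEquiv [DecidableEq ι] (e : ∀ i, A i ≃ₗ[R] B i) :
    letI := transportGSemiring e
    letI := transportGAlgebra e
    (⨁ i, A i) ≃ₐ[R] (⨁ i, B i) :=
  letI := transportGSemiring e
  letI := transportGAlgebra e
  AlgEquiv.ofLinearEquiv (DFinsupp.mapRange.linearEquiv e)
    (mapRange_linearEquiv_of e 0 GOne.one)
    (by
      intro x y
      induction x using DirectSum.induction_on with
      | zero => simp only [zero_mul, map_zero]
      | add x₁ x₂ h₁ h₂ => simp only [add_mul, map_add, h₁, h₂]
      | of i a =>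
        induction y using DirectSum.induction_on with
        | zero => simp only [mul_zero, map_zero]
        | add y₁ y₂ h₁ h₂ => simp only [mul_add, map_add, h₁, h₂]
        | of j b =>
          rw [DirectSum.of_mul_of, mapRange_linearEquiv_of, mapRange_linearEquiv_of,
            mapRange_linearEquiv_of, DirectSum.of_mul_of]
          exact DirectSum.of_eq_of_gradedMonoid_eq
            (gradedMap_mul e (GradedMonoid.mk i a) (GradedMonoid.mk j b)))

theorem transportAlgEquiv_of [DecidableEq ι] (e : ∀ i, A i ≃ₗ[R] B i) (i : ι) (a : A i) :
    letI := transportGSemiring e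
    letI := transportGAlgebra e
    transportAlgEquiv e (DirectSum.of A i a) = DirectSum.of B i (e i a) :=
  mapRange_linearEquiv_of e i a

end DirectSum

namespace HochschildGroup

/-! ### The comparison maps on cohomology -/

section Cohomology

variable {k G : Type*} [Field k] [Group G] (D : ClassData G)

theorem hat_mem_groupCocycles {n : ℕ} {φ : (Fin n → G) → MonoidAlgebra k G}
    (hφ : φ ∈ hochschildCocycles k G n) (x : G) : hat φ x ∈ groupCocycles k (Cent x) n := by
  refine ⟨hat_mem_normalizedCochains x hφ.1, ?_⟩
  have h : barD (leftMul k) (rightMul k) n φ = 0 := hφ.2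
  refine LinearMap.mem_ker.2 ?_
  rw [← hat_barD, h]
  funext g
  simp [hat]

theorem hat_mem_coboundaries {n : ℕ} {φ : (Fin n → G) → MonoidAlgebra k G}
    (hφ : φ ∈ coboundaries (leftMul k) (rightMul k) n) (x : G) :
    hat φ x ∈ coboundaries (fun _ : Cent x => (LinearMap.id : k →ₗ[k] k))
      (fun _ => LinearMap.id) n := by
  cases n with
  | zero =>
    rw [(Submodule.mem_bot k).1 hφ]
    refine (Submodule.mem_bot k).2 ?_
    funext g
    simp [hat]
  | succ m =>
    obtain ⟨u, hu, rfl⟩ := hφ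
    exact ⟨hat u x, hat_mem_normalizedCochains x hu, (hat_barD x u).symm⟩

theorem unhat_mem_hochschildCocycles {n : ℕ} (ψ : (x : D.X) → groupCocycles k (Cent (x : G)) n) :
    unhat D (fun x => (ψ x).1) ∈ hochschildCocycles k G n := by
  refine ⟨unhat_mem_normalizedCochains D fun x => (ψ x).2.1, ?_⟩
  have h : ∀ x : D.X, barD (fun _ : Cent (x : G) => (LinearMap.id : k →ₗ[k] k))
      (fun _ => LinearMap.id) n (ψ x).1 = 0 := fun x => (ψ x).2.2
  refine LinearMap.mem_ker.2 ?_
  rw [← unhat_barD]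
  simp only [h, unhat_zero]

theorem unhat_mem_coboundaries {n : ℕ} {ψ : (x : D.X) → (Fin n → Cent (x : G)) → k}
    (hψ : ∀ x : D.X, ψ x ∈ coboundaries (fun _ : Cent (x : G) => (LinearMap.id : k →ₗ[k] k))
      (fun _ => LinearMap.id) n) :
    unhat D ψ ∈ coboundaries (leftMul k) (rightMul k) n := by
  cases n with
  | zero =>
    have h : ψ = fun x => 0 := funext fun x => (Submodule.mem_bot k).1 (hψ x)
    rw [h, unhat_zero]
    exact Submodule.zero_mem _
  | succ m =>
    choose u hu hψu using hψ
    refine ⟨unhat D u, unhat_mem_normalizedCochains D hu, ?_⟩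
    rw [← unhat_barD]
    congr 1
    exact funext hψu

/-- The map `φ ↦ φ̂_x` on cocycles. -/
def hatCocycle (k : Type*) {G : Type*} [Field k] [Group G] (n : ℕ) (x : G) :
    hochschildCocycles k G n →ₗ[k] groupCocycles k (Cent x) n where
  toFun φ := ⟨hat φ.1 x, hat_mem_groupCocycles φ.2 x⟩
  map_add' φ φ' := by ext1; funext h; simp [hat, mul_add]
  map_smul' c φ := by ext1; funext h; simp [hat, mul_left_comm]

theorem tupleProd_append {n m : ℕ} (g : Fin (n + m) → G) :
    tupleProd g = tupleProd (fun i => g (Fin.castAdd m i)) * tupleProd fun j => g (Fin.natAdd n j) := by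
  simp only [tupleProd, ← List.prod_append, ← List.ofFn_fin_append]
  congr 2
  exact (Fin.append_castAdd_natAdd (f := g)).symm

variable [DecidableEq G]

/-- The map `φ ↦ ∑_{x ∈ X} [φ̂_x]` on cocycles. -/
def hatSum (k : Type*) [Field k] (n : ℕ) :
    hochschildCocycles k G n →ₗ[k] CentralizerCohomology k D n :=
  ∑ x : D.X, (DirectSum.lof k D.X (fun x : D.X => GroupCohomology k (Cent (x : G)) n) x).comp
    ((Submodule.mkQ _).comp (hatCocycle k n (x : G)))

theorem hatSum_apply (n : ℕ) (φ : hochschildCocycles k G n) :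
    hatSum D k n φ = ∑ x : D.X, DirectSum.of (fun x : D.X => GroupCohomology k (Cent (x : G)) n) x
      (groupClass ⟨hat φ.1 (x : G), hat_mem_groupCocycles φ.2 (x : G)⟩) :=
  LinearMap.sum_apply _ _ _

theorem hatSum_eq_zero {n : ℕ} {φ : hochschildCocycles k G n}
    (hφ : φ.1 ∈ coboundaries (leftMul k) (rightMul k) n) : hatSum D k n φ = 0 := by
  rw [hatSum_apply]
  refine Finset.sum_eq_zero fun x _ => ?_
  have : groupClass ⟨hat φ.1 (x : G), hat_mem_groupCocycles φ.2 (x : G)⟩ = 0 :=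
    (Submodule.Quotient.mk_eq_zero _).2 (hat_mem_coboundaries hφ (x : G))
  rw [this, map_zero]

/-- The map `[φ] ↦ ∑_{x ∈ X} [φ̂_x]`. -/
def hatCohomology (k : Type*) [Field k] (n : ℕ) : HH k G n →ₗ[k] CentralizerCohomology k D n :=
  -- Negation is scalar multiplication by −1, so the additive monoid of the direct sum is kept.
  letI : AddCommGroup (CentralizerCohomology k D n) := Module.addCommMonoidToAddCommGroup k
  Submodule.liftQ
    ((coboundaries (leftMul k) (rightMul k) n).submoduleOf (hochschildCocycles k G n))
    (hatSum D k n) (fun _ hφ => LinearMap.mem_ker.2 (hatSum_eq_zero D hφ))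

theorem hatCohomology_class (n : ℕ) (φ : hochschildCocycles k G n) :
    hatCohomology D k n (hochschildClass n φ)
      = ∑ x : D.X, DirectSum.of (fun x : D.X => GroupCohomology k (Cent (x : G)) n) x
        (groupClass ⟨hat φ.1 (x : G), hat_mem_groupCocycles φ.2 (x : G)⟩) :=
  hatSum_apply D n φ

theorem hatCohomology_unhat (n : ℕ) (ψ : (x : D.X) → groupCocycles k (Cent (x : G)) n) :
    hatCohomology D k n (hochschildClass n
        ⟨unhat D (fun x => (ψ x).1), unhat_mem_hochschildCocycles D ψ⟩)
      = ∑ x : D.X, DirectSum.of (fun x : D.X => GroupCohomology k (Cent (x : G)) n) x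
        (groupClass (ψ x)) := by
  rw [hatCohomology_class]
  refine Finset.sum_congr rfl fun x _ => ?_
  congr 2
  exact Subtype.ext (hat_unhat D _ x)

theorem hatCohomology_bijective (n : ℕ) : Function.Bijective (hatCohomology (G := G) D k n) := by
  constructor
  · rw [injective_iff_map_eq_zero]
    intro c hc
    obtain ⟨φ, rfl⟩ := hochschildClass_surjective n c
    rw [hatCohomology_class] at hc
    have h : ∀ x : D.X, hat φ.1 (x : G) ∈ coboundaries
        (fun _ : Cent (x : G) => (LinearMap.id : k →ₗ[k] k)) (fun _ => LinearMap.id) n := by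
      intro x
      have hx := DFunLike.congr_fun hc x
      rw [DFinsupp.finsetSum_apply, Finset.sum_eq_single x
        (fun y _ hne => DirectSum.of_eq_of_ne (β := fun x : D.X => GroupCohomology k (Cent (x : G)) n)
          y x _ (Ne.symm hne)) (by simp), DirectSum.of_eq_same] at hx
      have hx' : (Submodule.Quotient.mk ⟨hat φ.1 (x : G), hat_mem_groupCocycles φ.2 (x : G)⟩ :
        GroupCohomology k (Cent (x : G)) n) = 0 := hx
      exact (Submodule.Quotient.mk_eq_zero
        ((coboundaries _ _ n).submoduleOf (groupCocycles k (Cent (x : G)) n))).1 hx'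
    refine (Submodule.Quotient.mk_eq_zero _).2 ?_
    -- φ is the sum of φ − `unhat` (`hat` φ), a coboundary by the homotopy, and of `unhat` of a
    -- family of coboundaries.
    have := Submodule.add_mem _ (sub_unhat_hat_mem_coboundaries D φ.2) (unhat_mem_coboundaries D h)
    rw [sub_add_cancel] at this
    exact this
  · intro c
    choose ψ hψ using fun x : D.X => Submodule.Quotient.mk_surjective _ (c x)
    refine ⟨_, (hatCohomology_unhat D n ψ).trans ?_⟩
    have : ∀ x, groupClass (ψ x) = c x := hψ
    simp only [this]
    exact DirectSum.sum_univ_of c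

/-- The isomorphism `HHⁿ(kG) ≃ ⨁_{x ∈ X} Hⁿ(C_G(x), k)`. -/
def hatEquiv (k : Type*) [Field k] (n : ℕ) : HH k G n ≃ₗ[k] CentralizerCohomology k D n :=
  LinearEquiv.ofBijective (hatCohomology D k n) (hatCohomology_bijective D n)

theorem hatEquiv_symm_sum (n : ℕ) (ψ : (x : D.X) → groupCocycles k (Cent (x : G)) n) :
    (hatEquiv D k n).symm
        (∑ x : D.X, DirectSum.of (fun x : D.X => GroupCohomology k (Cent (x : G)) n) x
          (groupClass (ψ x)))
      = hochschildClass n ⟨unhat D (fun x => (ψ x).1), unhat_mem_hochschildCocycles D ψ⟩ := by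
  rw [LinearEquiv.symm_apply_eq]
  exact (hatCohomology_unhat D n ψ).symm

/-! ### The cup product on representatives. -/

theorem sum_of_single {n : ℕ} (x : D.X) (a : groupCocycles k (Cent (x : G)) n) :
    ∑ y : D.X, DirectSum.of (fun y : D.X => GroupCohomology k (Cent (y : G)) n) y
        (groupClass ((Pi.single x a : (y : D.X) → groupCocycles k (Cent (y : G)) n) y))
      = DirectSum.of (fun y : D.X => GroupCohomology k (Cent (y : G)) n) x (groupClass a) := by
  rw [Finset.sum_eq_single x, Pi.single_eq_same]
  · intro y _ hne
    rw [Pi.single_eq_of_ne hne]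
    exact map_zero _
  · simp

theorem unhat_single {n : ℕ} (x : D.X) (a : groupCocycles k (Cent (x : G)) n) (g : Fin n → G) :
    unhat D (fun y => ((Pi.single x a : (y : D.X) → groupCocycles k (Cent (y : G)) n) y).1) g
      = (-1 : k) ^ (n * (n + 1) / 2) • (MonoidAlgebra.single (tupleProd g) (1 : k) *
        ∑ γ ∈ D.S x, MonoidAlgebra.single (γ⁻¹ * (x : G) * γ) (a.1 (D.hSeq x γ (revInv g)))) := by
  rw [unhat, Finset.sum_eq_single x, Pi.single_eq_same]
  · intro y _ hne
    rw [Pi.single_eq_of_ne hne]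
    simp
  · simp

/-- Split h as (u, v) with u of length m, and write u, v also for the products. Reversal feeds v to
the first factor and u to the second, so the group elements that occur are uv · v⁻¹xᵢ · u⁻¹yⱼ = u xᵢ
u⁻¹ yⱼ; the coefficient of z selects the pairs in the index set. -/
theorem hat_cup_unhat_single {n m : ℕ} {x y : D.X} (a : groupCocycles k (Cent (x : G)) n)
    (b : groupCocycles k (Cent (y : G)) m) (z : D.X) :
    hat (cup
        (unhat D fun w => ((Pi.single x a : (w : D.X) → groupCocycles k (Cent (w : G)) n) w).1)
        (unhat D fun w => ((Pi.single y b : (w : D.X) → groupCocycles k (Cent (w : G)) m) w).1))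
      (z : G) = twistedCup D a.1 b.1 z := by
  funext h
  set u : Fin m → G := fun j => h (Fin.cast (Nat.add_comm m n) (Fin.castAdd n j)) with hu
  set v : Fin n → G := fun i => h (Fin.cast (Nat.add_comm m n) (Fin.natAdd m i)) with hv
  have e1 : (fun i => revInv (fun i => (h i : G)) (Fin.castAdd m i)) = revInv v := by
    funext i
    simp only [revInv, hv]
    congr 3
    ext
    simp
    omega
  have e2 : (fun j => revInv (fun i => (h i : G)) (Fin.natAdd n j)) = revInv u := by
    funext i
    simp only [revInv, hu]
    congr 3
    ext
    simp
    omega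
  have e3 : tupleProd (fun i => (h i : G)) = tupleProd u * tupleProd v := by
    have := tupleProd_append (revInv fun i => (h i : G))
    rw [e1, e2, tupleProd_revInv, tupleProd_revInv, tupleProd_revInv, ← mul_inv_rev] at this
    exact inv_injective this
  -- Triangular numbers satisfy T(n + m) = T(n) + T(m) + nm; only the sign (-1)^{nm} survives.
  have e4 : (-1 : k) ^ ((n + m) * (n + m + 1) / 2) *
      ((-1) ^ (n * (n + 1) / 2) * (-1) ^ (m * (m + 1) / 2)) = (-1) ^ (n * m) := by
    have : (n + m) * (n + m + 1) / 2 = n * (n + 1) / 2 + m * (m + 1) / 2 + n * m := by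
      have h1 := Nat.div_mul_cancel (Nat.even_mul_succ_self n).two_dvd
      have h2 := Nat.div_mul_cancel (Nat.even_mul_succ_self m).two_dvd
      refine Nat.div_eq_of_eq_mul_left two_pos ?_
      linear_combination -h1 - h2
    rw [this, pow_add, pow_add, mul_right_comm, ← pow_add, sign_mul_self, one_mul]
  change _ = (-1 : k) ^ (n * m) *
    ∑ p ∈ (D.S x ×ˢ D.S y).filter (fun p : G × G =>
        tupleProd u * (p.1⁻¹ * (x : G) * p.1) * (tupleProd u)⁻¹ * (p.2⁻¹ * (y : G) * p.2) = z),
      a.1 (D.hSeq x p.1 v) * b.1 (D.hSeq y p.2 u)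
  rw [hat, cup, e1, e2, e3, unhat_single, unhat_single, revInv_revInv, revInv_revInv,
    tupleProd_revInv, tupleProd_revInv]
  rw [smul_mul_smul_comm, mul_smul_comm, smul_smul, e4, MonoidAlgebra.coeff_smul_apply,
    smul_eq_mul]
  congr 1
  rw [Finset.sum_filter, Finset.sum_product]
  simp only [Finset.mul_sum, Finset.sum_mul, MonoidAlgebra.single_mul_single,
    MonoidAlgebra.coeff_sum, Finsupp.finsetSum_apply, MonoidAlgebra.coeff_single,
    Finsupp.single_apply, one_mul]
  rw [Finset.sum_comm]
  refine Finset.sum_congr rfl fun γ _ => Finset.sum_congr rfl fun η _ => ?_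
  congr 2
  group

end Cohomology

end HochschildGroup

end

/-! ### The transported algebra and the isomorphism. -/

theorem mainTheorem6 (k : Type*) [Field k] (G : Type*) [Group G] [Finite G] [DecidableEq G]
    (D : ClassData G) :
    ∃ (_ : DirectSum.GSemiring (CentralizerCohomology k D))
      (_ : DirectSum.GAlgebra k (CentralizerCohomology k D)),
      (∀ (n m : ℕ) (x y : D.X) (a : groupCocycles k (Cent (x : G)) n)
          (b : groupCocycles k (Cent (y : G)) m),
        ∃ h : ∀ z : D.X, twistedCup D a.1 b.1 z ∈ groupCocycles k (Cent (z : G)) (n + m),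
          (GradedMonoid.GMul.mul
              (DirectSum.of (fun x : D.X => GroupCohomology k (Cent (x : G)) n) x (groupClass a) :
                CentralizerCohomology k D n)
              (DirectSum.of (fun y : D.X => GroupCohomology k (Cent (y : G)) m) y (groupClass b) :
                CentralizerCohomology k D m) :
            CentralizerCohomology k D (n + m)) =
          ∑ z : D.X, DirectSum.of (fun z : D.X => GroupCohomology k (Cent (z : G)) (n + m)) z
            (groupClass ⟨twistedCup D a.1 b.1 z, h z⟩)) ∧
      ∃ Φ : (⨁ n, HH k G n) ≃ₐ[k] (⨁ n, CentralizerCohomology k D n),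
        (∀ (n : ℕ) (φ : hochschildCocycles k G n),
          ∃ h : ∀ x : D.X, hat φ.1 (x : G) ∈ groupCocycles k (Cent (x : G)) n,
            Φ (DirectSum.of (HH k G) n (hochschildClass n φ)) =
              DirectSum.of (CentralizerCohomology k D) n
                (∑ x : D.X, DirectSum.of (fun x : D.X => GroupCohomology k (Cent (x : G)) n) x
                  (groupClass ⟨hat φ.1 (x : G), h x⟩))) ∧
        (∀ (n : ℕ) (ψ : (x : D.X) → groupCocycles k (Cent (x : G)) n),
          ∃ h : unhat D (fun x => (ψ x).1) ∈ hochschildCocycles k G n,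
            Φ.symm (DirectSum.of (CentralizerCohomology k D) n
                (∑ x : D.X, DirectSum.of (fun x : D.X => GroupCohomology k (Cent (x : G)) n) x
                  (groupClass (ψ x)))) =
              DirectSum.of (HH k G) n (hochschildClass n ⟨unhat D (fun x => (ψ x).1), h⟩)) := by
  let e := hatEquiv (G := G) D k
  let _ := DirectSum.transportGSemiring e
  let _ := DirectSum.transportGAlgebra e
  refine ⟨DirectSum.transportGSemiring e, DirectSum.transportGAlgebra e, ?_, ?_⟩
  · intro n m x y a b
    have h : ∀ z : D.X, twistedCup D a.1 b.1 z ∈ groupCocycles k (Cent (z : G)) (n + m) := by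
      intro z
      -- The twisted product is a cocycle because it is the restriction of a cup product of
      -- Hochschild cocycles.
      rw [← hat_cup_unhat_single]
      exact hat_mem_groupCocycles (cup_cocycle (unhat_mem_hochschildCocycles D _)
        (unhat_mem_hochschildCocycles D _)) _
    refine ⟨h, ?_⟩
    change hatEquiv D k (n + m) (hhMul n m ((hatEquiv D k n).symm _) ((hatEquiv D k m).symm _)) = _
    -- Each factor is viewed as a family supported at one class, so that the inverse isomorphism is
    -- given by `unhat` on cocycles.
    rw [← sum_of_single, ← sum_of_single, hatEquiv_symm_sum, hatEquiv_symm_sum, hhMul_class]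
    refine (hatCohomology_class D (n + m) _).trans (Finset.sum_congr rfl fun z _ => ?_)
    congr 2
    exact Subtype.ext (hat_cup_unhat_single D a b z)
  · refine ⟨DirectSum.transportAlgEquiv e, fun n φ => ⟨fun x => hat_mem_groupCocycles φ.2 _, ?_⟩,
      fun n ψ => ⟨unhat_mem_hochschildCocycles D ψ, ?_⟩⟩
    · exact (DirectSum.transportAlgEquiv_of e n _).trans (congrArg _ (hatCohomology_class D n φ))
    · rw [← hatEquiv_symm_sum, AlgEquiv.symm_apply_eq, DirectSum.transportAlgEquiv_of]
      exact congrArg _ (LinearEquiv.apply_symm_apply _ _).symm
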